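/- Let $Y=\{y_1,\dots,y_n\}\subset\mathbb R$ with $y_1<\dots<y_n$. For $d=1,2$ let $H^{1}(\mathbb R\setminus Y;\mathbb C^d)$ (resp. $H^{2}(\mathbb R\setminus Y;\mathbb C^d)$) be the space of $f\in L^2(\mathbb R;\mathbb C^d)$ whose distributional derivative (resp. first two distributional derivatives) on $\mathbb R\setminus Y$ belong to $L^2$; write $f'$ for this derivative, $[f]_{y}=f(y^+)-f(y^-)$, $\langle f\rangle_y=\frac12(f(y^+)+f(y^-))$. Let $\sigma_1,\sigma_3$ be Pauli matrices and let $$\mathsf D_{\mathbb R\setminus Y}=-i\sigma_1\frac{d}{dx}+\frac12\sigma_3,\qquad \mathsf H_{\mathbb R\setminus Y}=-\frac{d^2}{dx^2}$$ act in the sense of distributions on $\mathbb R\setminus Y$; $\mathsf D$ and $\mathsf H$ are the free operators on $H^1(\mathbb R;\mathbb C^2)$ and $H^2(\mathbb R)$. **Couples.** A couple $(\Pi,\Theta)$ in $\mathbb C^m$ consists of an orthogonal projector $\Pi$ in $\mathbb C^{m}$ and a symmetric operator $\Theta$ in $\mathrm{ran}(\Pi)$. For a couple in $\mathbb C^{2n}$,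 $\mathsf D_{\Pi,\Theta}$ is the operator in $L^2(\mathbb R;\mathbb C^2)$ with domain the set of all $\Psi=\Psi_z+G_z\xi$ with $\Psi_z\in H^1(\mathbb R;\mathbb C^2)$, $\xi\in\mathrm{ran}(\Pi)$ and $\Pi(\langle\Psi\rangle_{y_k})_{k}=\Theta\xi$, and with $(-\mathsf D_{\Pi,\Theta}+z)\Psi=(-\mathsf D+z)\Psi_z$. Here $z\in\mathbb C\setminus((-\infty,-\frac12]\cup[\frac12,\infty))$, $[G_z\xi](x)=\sum_k g_z(x-y_k)\xi_k$, and $g_z=(\mathsf D+z)\,\widehat g_{z^2-1/4}$ (applied to $\widehat g_{z^2-1/4}$ times the identity matrix) with $\widehat g_w(x)=e^{i\sqrt w|x|}/(2i\sqrt w)$, $\mathrm{Im}\sqrt w>0$. For a couple in $\mathbb C^{4n}$, $\widehat{\mathsf H}_{\widehat\Pi,\widehat\Theta}$ is the operator in $L^2(\mathbb R;\mathbb C^2)$ with domain the set of all $\Psi=(\psi_1,\psi_2)=\Psi_z+\widehat G_z\xi$ with $\Psi_z\in H^2(\mathbb R;\mathbb C^2)$, $\xi\in\mathrm{ran}(\widehat\Pi)$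 and $\widehat\Pi v=\widehat\Theta\xi$, where $v_k=(\langle\psi_1\rangle_{y_k},\langle\psi_1'\rangle_{y_k},\langle\psi_2\rangle_{y_k},\langle\psi_2'\rangle_{y_k})$, and with $(-\widehat{\mathsf H}_{\widehat\Pi,\widehat\Theta}+z)\Psi=(-\mathsf H+z)\Psi_z$ componentwise. Here $z\in\mathbb C\setminus[0,\infty)$, $\xi=(\xi_k)_k$ with $\xi_k\in\mathbb C^4$, and $$[\widehat G_z\xi]_j(x)=\sum_k\big(\widehat g_z(y_k-x)\,\xi_{k,2j-1}+\widehat g_z'(y_k-x)\,\xi_{k,2j}\big),\qquad j=1,2.$$ **Gesztesy–Šeba operators.** For $\alpha=(\alpha_k),\beta=(\beta_k)\in\mathbb R^n$ let $\mathsf D_\alpha$ and $\mathsf D_\beta$ be the restrictions of $\mathsf D_{\mathbb R\setminus Y}$ to $$\mathrm{dom}(\mathsf D_\alpha)=\{(\psi_1,\psi_2)\in H^1(\mathbb R)\oplus H^1(\mathbb R\setminus Y):[\psi_2]_{y_k}=-i\alpha_k\psi_1(y_k),\ 1\le k\le n\},$$ $$\mathrm{dom}(\mathsf D_\beta)=\{(\psi_1,\psi_2)\in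 H^1(\mathbb R\setminus Y)\oplus H^1(\mathbb R):[\psi_1]_{y_k}=-i\beta_k\psi_2(y_k),\ 1\le k\le n\}.$$ **Theorem.** $\mathsf D_\alpha$ and $\mathsf D_\beta$ are self-adjoint, and there are self-adjoint operators $\widehat{\mathsf H}_\alpha$, $\widehat{\mathsf H}_\beta$ in $L^2(\mathbb R;\mathbb C^2)$ such that (equality of unbounded operators, domains included) $$(\mathsf D_\alpha)^2=\widehat{\mathsf H}_\alpha+\tfrac14,\qquad (\mathsf D_\beta)^2=\widehat{\mathsf H}_\beta+\tfrac14 .$$ Both act as $\mathsf H_{\mathbb R\setminus Y}$ on each component, and their domains are $$\mathrm{dom}(\widehat{\mathsf H}_\alpha)=\{(\psi_1,\psi_2)\in H^2(\mathbb R\setminus Y;\mathbb C^2):[\psi_1]_{y_k}=[\psi_2']_{y_k}=0,\ [\psi_1']_{y_k}=\alpha_k(\psi_1(y_k)-i\psi_2'(y_k)),\ [\psi_2]_{y_k}=-i\alpha_k\psi_1(y_k),\ 1\le k\le n\},$$ $$\mathrm{dom}(\widehat{\mathsf H}_\beta)=\{(\psi_1,\psi_2)\in H^2(\mathbb R\setminus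 Y;\mathbb C^2):[\psi_1']_{y_k}=[\psi_2]_{y_k}=0,\ [\psi_1]_{y_k}=-i\beta_k\psi_2(y_k),\ [\psi_2']_{y_k}=-\beta_k(\psi_2(y_k)+i\psi_1'(y_k)),\ 1\le k\le n\}.$$ If moreover all $\alpha_k\neq0$ then, whatever the admissible $z$ used in the definitions above, $\mathsf D_\alpha=\mathsf D_{\Pi,\Theta}$ and $\widehat{\mathsf H}_\alpha=\widehat{\mathsf H}_{\widehat\Pi,\widehat\Theta}$ with $\Pi=\oplus_k\Pi_k$, $\Theta=\oplus_k\Theta_k$, $\widehat\Pi=\oplus_k\widehat\Pi_k$, $\widehat\Theta=\oplus_k\widehat\Theta_k$, where $$\mathrm{ran}(\Pi_k)=\mathbb C\oplus\{0\},\quad \Theta_k=\alpha_k^{-1},\quad \mathrm{ran}(\widehat\Pi_k)=\mathbb C\oplus\{0\}\oplus\{0\}\oplus\mathbb C\equiv\mathbb C^2,\quad \widehat\Theta_k=\frac1{\alpha_k}\begin{bmatrix}0&-i\\ i&-1\end{bmatrix}.$$ If all $\beta_k\ne0$ then, in the same way, $\mathsf D_\beta=\mathsf D_{\Pi,\Theta}$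 and $\widehat{\mathsf H}_\beta=\widehat{\mathsf H}_{\widehat\Pi,\widehat\Theta}$ with $$\mathrm{ran}(\Pi_k)=\{0\}\oplus\mathbb C,\quad \Theta_k=\beta_k^{-1},\quad \mathrm{ran}(\widehat\Pi_k)=\{0\}\oplus\mathbb C\oplus\mathbb C\oplus\{0\}\equiv\mathbb C^2,\quad \widehat\Theta_k=\frac1{\beta_k}\begin{bmatrix}1&i\\ -i&0\end{bmatrix}.$$ -/

import Mathlib

open MeasureTheory Filter Topology
open scoped ContDiff Matrix

noncomputable section

namespace PointInt

/-- `L²(ℝ)`, complex valued. -/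
abbrev L2 : Type := Lp ℂ 2 (volume : Measure ℝ)

/-- `L²(ℝ; ℂ²) = L²(ℝ) ⊕ L²(ℝ)` (Hilbert sum); the components of `Ψ` are `Ψ.fst` and `Ψ.snd`. -/
abbrev Spinor : Type := WithLp 2 (L2 × L2)

/-! ### Sobolev spaces on `ℝ \ S`, `S` a finite set -/

/-- `g` is the distributional derivative of `f` on the open set `ℝ \ S`. -/
def HasWeakDeriv (S : Finset ℝ) (f g : L2) : Prop :=
  ∀ φ : ℝ → ℝ, ContDiff ℝ ∞ φ → HasCompactSupport φ → tsupport φ ⊆ (S : Set ℝ)ᶜ →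
    ∫ x, deriv φ x • f x = -∫ x, φ x • g x

theorem integrable_smul_L2 {φ : ℝ → ℝ} (h1 : Continuous φ) (h2 : HasCompactSupport φ) (f : L2) :
    Integrable (fun x => φ x • f x) :=
  LocallyIntegrable.integrable_smul_left_of_hasCompactSupport
    ((Lp.memLp f).locallyIntegrable (by norm_num)) h1 h2

theorem integral_smul_add {φ : ℝ → ℝ} (h1 : Continuous φ) (h2 : HasCompactSupport φ) (f g : L2) :
    ∫ x, φ x • (f + g : L2) x = (∫ x, φ x • f x) + ∫ x, φ x • g x := by
  rw [← integral_add (integrable_smul_L2 h1 h2 f) (integrable_smul_L2 h1 h2 g)]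
  apply integral_congr_ae
  filter_upwards [Lp.coeFn_add f g] with x hx
  rw [hx, Pi.add_apply, smul_add]

theorem integral_smul_smul (φ : ℝ → ℝ) (c : ℂ) (f : L2) :
    ∫ x, φ x • (c • f : L2) x = c • ∫ x, φ x • f x := by
  rw [← integral_smul]
  apply integral_congr_ae
  filter_upwards [Lp.coeFn_smul c f] with x hx
  rw [hx, Pi.smul_apply, smul_comm]

theorem HasWeakDeriv.add {S : Finset ℝ} {f f' g g' : L2} (hf : HasWeakDeriv S f f')
    (hg : HasWeakDeriv S g g') : HasWeakDeriv S (f + g) (f' + g') := by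
  intro φ h1 h2 h3
  rw [integral_smul_add (h1.continuous_deriv (by simp)) h2.deriv, integral_smul_add h1.continuous h2,
    hf φ h1 h2 h3, hg φ h1 h2 h3]
  ring

theorem HasWeakDeriv.smul {S : Finset ℝ} {f f' : L2} (hf : HasWeakDeriv S f f') (c : ℂ) :
    HasWeakDeriv S (c • f) (c • f') := by
  intro φ h1 h2 h3
  rw [integral_smul_smul, integral_smul_smul, hf φ h1 h2 h3, smul_neg]

theorem HasWeakDeriv.unique {S : Finset ℝ} {f g g' : L2} (h : HasWeakDeriv S f g)
    (h' : HasWeakDeriv S f g') : g = g' := by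
  have key : ∀ᵐ x : ℝ, x ∈ ((S : Set ℝ)ᶜ) → (g + (-1 : ℂ) • g' : L2) x = 0 := by
    apply IsOpen.ae_eq_zero_of_integral_contDiff_smul_eq_zero S.finite_toSet.isClosed.isOpen_compl
    · exact ((Lp.memLp _).locallyIntegrable (by norm_num)).locallyIntegrableOn _
    · intro φ h1 h2 h3
      have e := (h φ h1 h2 h3).symm.trans (h' φ h1 h2 h3)
      rw [integral_smul_add h1.continuous h2, integral_smul_smul, neg_inj.mp e]
      simp
  have hS : ∀ᵐ x : ℝ, x ∈ ((S : Set ℝ)ᶜ) :=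
    compl_mem_ae_iff.mpr (S.finite_toSet.measure_zero volume)
  have h0 : g + (-1 : ℂ) • g' = 0 := by
    apply Lp.ext
    filter_upwards [key, hS, Lp.coeFn_zero ℂ 2 (volume : Measure ℝ)] with x hx hxS hz
    rw [hx hxS, hz, Pi.zero_apply]
  rwa [neg_one_smul, ← sub_eq_add_neg, sub_eq_zero] at h0

/-- `H¹(ℝ \ S)`: functions in `L²` whose distributional derivative on `ℝ \ S` is in `L²`. -/
def H1 (S : Finset ℝ) : Submodule ℂ L2 where
  carrier := {f | ∃ g, HasWeakDeriv S f g}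
  zero_mem' := ⟨(0 : ℂ) • 0, by
    intro φ _ _ _
    have h : (0 : L2) = (0 : ℂ) • (0 : L2) := by simp
    rw [h, smul_zero, ← h, h, integral_smul_smul, integral_smul_smul]; simp⟩
  add_mem' := fun ⟨a, ha⟩ ⟨b, hb⟩ => ⟨a + b, ha.add hb⟩
  smul_mem' := fun c _ ⟨a, ha⟩ => ⟨c • a, ha.smul c⟩

theorem H1_empty_le (S : Finset ℝ) : H1 ∅ ≤ H1 S :=
  fun _ ⟨g, hg⟩ => ⟨g, fun φ h1 h2 _ => hg φ h1 h2 (by simp)⟩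

open Classical in
/-- The distributional derivative on `ℝ \ S` of `f ∈ H¹(ℝ \ S)` (zero for other `f`). -/
def weakDeriv (S : Finset ℝ) (f : L2) : L2 :=
  if h : ∃ g, HasWeakDeriv S f g then h.choose else 0

theorem hasWeakDeriv_weakDeriv {S : Finset ℝ} {f : L2} (h : f ∈ H1 S) :
    HasWeakDeriv S f (weakDeriv S f) := by
  have h' : ∃ g, HasWeakDeriv S f g := h
  rw [weakDeriv, dif_pos h']
  exact h'.choose_spec

theorem weakDeriv_add {S : Finset ℝ} {f g : L2} (hf : f ∈ H1 S) (hg : g ∈ H1 S) :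
    weakDeriv S (f + g) = weakDeriv S f + weakDeriv S g :=
  (hasWeakDeriv_weakDeriv ((H1 S).add_mem hf hg)).unique
    ((hasWeakDeriv_weakDeriv hf).add (hasWeakDeriv_weakDeriv hg))

theorem weakDeriv_smul {S : Finset ℝ} (c : ℂ) {f : L2} (hf : f ∈ H1 S) :
    weakDeriv S (c • f) = c • weakDeriv S f :=
  (hasWeakDeriv_weakDeriv ((H1 S).smul_mem c hf)).unique ((hasWeakDeriv_weakDeriv hf).smul c)

/-- `f ∈ H²(ℝ \ S)`: `f ∈ H¹(ℝ \ S)` and `f' ∈ H¹(ℝ \ S)`. -/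
def MemH2 (S : Finset ℝ) (f : L2) : Prop := f ∈ H1 S ∧ weakDeriv S f ∈ H1 S

/-! ### Boundary values. Limits are essential limits, hence independent of the representative. -/

/-- `f(y⁻) = c`. -/
def HasLeftValue (f : L2) (y : ℝ) (c : ℂ) : Prop := Tendsto f (𝓝[<] y ⊓ ae volume) (𝓝 c)

/-- `f(y⁺) = c`. -/
def HasRightValue (f : L2) (y : ℝ) (c : ℂ) : Prop := Tendsto f (𝓝[>] y ⊓ ae volume) (𝓝 c)

/-- `f(y) = c`: the (two-sided) essential limit of `f` at `y` exists and is `c`. -/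
def HasValue (f : L2) (y : ℝ) (c : ℂ) : Prop := Tendsto f (𝓝 y ⊓ ae volume) (𝓝 c)

/-- `[f]_y = f(y⁺) - f(y⁻) = c`. -/
def HasJump (f : L2) (y : ℝ) (c : ℂ) : Prop :=
  ∃ l r, HasLeftValue f y l ∧ HasRightValue f y r ∧ r - l = c

/-- `⟨f⟩_y = (f(y⁻) + f(y⁺)) / 2 = c`. -/
def HasMean (f : L2) (y : ℝ) (c : ℂ) : Prop :=
  ∃ l r, HasLeftValue f y l ∧ HasRightValue f y r ∧ (l + r) / 2 = c

theorem tendsto_add {F : Filter ℝ} {f g : L2} {a b : ℂ} (hf : Tendsto f (F ⊓ ae volume) (𝓝 a))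
    (hg : Tendsto g (F ⊓ ae volume) (𝓝 b)) :
    Tendsto (f + g : L2) (F ⊓ ae volume) (𝓝 (a + b)) :=
  (hf.add hg).congr' (EventuallyEq.filter_mono (Lp.coeFn_add f g).symm inf_le_right)

theorem tendsto_smul {F : Filter ℝ} {f : L2} {a : ℂ} (c : ℂ)
    (hf : Tendsto f (F ⊓ ae volume) (𝓝 a)) :
    Tendsto (c • f : L2) (F ⊓ ae volume) (𝓝 (c * a)) :=
  (hf.const_mul c).congr' (EventuallyEq.filter_mono (Lp.coeFn_smul c f).symm inf_le_right)

theorem tendsto_zero {F : Filter ℝ} : Tendsto (0 : L2) (F ⊓ ae volume) (𝓝 0) :=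
  tendsto_const_nhds.congr'
    (EventuallyEq.filter_mono (Lp.coeFn_zero ℂ 2 (volume : Measure ℝ)).symm inf_le_right)

theorem HasJump.add {f g : L2} {y : ℝ} {a b : ℂ} (hf : HasJump f y a) (hg : HasJump g y b) :
    HasJump (f + g) y (a + b) := by
  obtain ⟨l, r, h1, h2, rfl⟩ := hf
  obtain ⟨l', r', h1', h2', rfl⟩ := hg
  exact ⟨l + l', r + r', tendsto_add h1 h1', tendsto_add h2 h2', by ring⟩

theorem HasJump.smul {f : L2} {y : ℝ} {a : ℂ} (c : ℂ) (hf : HasJump f y a) :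
    HasJump (c • f) y (c * a) := by
  obtain ⟨l, r, h1, h2, rfl⟩ := hf
  exact ⟨c * l, c * r, tendsto_smul c h1, tendsto_smul c h2, by ring⟩

theorem hasJump_zero (y : ℝ) : HasJump 0 y 0 :=
  ⟨0, 0, tendsto_zero, tendsto_zero, by ring⟩

/-! ### Dirac and Schrödinger operators -/

/-- The set `Y = {y₁, …, yₙ}`. -/
def pts {n : ℕ} (y : Fin n → ℝ) : Finset ℝ := Finset.univ.image y

/-- The distributional Dirac operator on `ℝ \ S`:
`-i σ₁ d/dx + σ₃/2`, that is `(ψ₁, ψ₂) ↦ (-i ψ₂' + ψ₁/2, -i ψ₁' - ψ₂/2)`. -/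
def diracAct (S : Finset ℝ) (Ψ : Spinor) : Spinor :=
  WithLp.toLp 2 ((-Complex.I) • weakDeriv S Ψ.snd + (1 / 2 : ℂ) • Ψ.fst,
    (-Complex.I) • weakDeriv S Ψ.fst - (1 / 2 : ℂ) • Ψ.snd)

/-- The distributional Schrödinger operator `-d²/dx²` on `ℝ \ S`, acting componentwise. -/
def schrAct (S : Finset ℝ) (Ψ : Spinor) : Spinor :=
  WithLp.toLp 2 (-weakDeriv S (weakDeriv S Ψ.fst), -weakDeriv S (weakDeriv S Ψ.snd))

theorem diracAct_add {S : Finset ℝ} {Ψ Φ : Spinor} (h1 : Ψ.fst ∈ H1 S) (h2 : Ψ.snd ∈ H1 S)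
    (k1 : Φ.fst ∈ H1 S) (k2 : Φ.snd ∈ H1 S) :
    diracAct S (Ψ + Φ) = diracAct S Ψ + diracAct S Φ := by
  simp only [diracAct, WithLp.add_fst, WithLp.add_snd, weakDeriv_add h1 k1, weakDeriv_add h2 k2,
    ← WithLp.toLp_add, Prod.mk_add_mk, smul_add]
  congr 2 <;> abel

theorem diracAct_smul {S : Finset ℝ} (c : ℂ) {Ψ : Spinor} (h1 : Ψ.fst ∈ H1 S)
    (h2 : Ψ.snd ∈ H1 S) : diracAct S (c • Ψ) = c • diracAct S Ψ := by
  simp only [diracAct, WithLp.smul_fst, WithLp.smul_snd, weakDeriv_smul c h1, weakDeriv_smul c h2,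
    ← WithLp.toLp_smul, Prod.smul_mk, smul_add, smul_sub, smul_comm c]

/-- The Dirac operator `D_α`: `ψ₁ ∈ H¹(ℝ)`, `ψ₂ ∈ H¹(ℝ \ Y)`, `[ψ₂]_{y_k} = -i α_k ψ₁(y_k)`,
acting as the distributional Dirac operator on `ℝ \ Y`. -/
def diracAlpha {n : ℕ} (y α : Fin n → ℝ) : Spinor →ₗ.[ℂ] Spinor where
  domain :=
    { carrier := {Ψ | Ψ.fst ∈ H1 ∅ ∧ Ψ.snd ∈ H1 (pts y) ∧
        ∀ k, ∃ a, HasValue Ψ.fst (y k) a ∧ HasJump Ψ.snd (y k) (-Complex.I * α k * a)}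
      zero_mem' := ⟨zero_mem _, zero_mem _, fun k =>
        ⟨0, tendsto_zero, by simpa using hasJump_zero (y k)⟩⟩
      add_mem' := by
        rintro Ψ Φ ⟨h1, h2, h3⟩ ⟨k1, k2, k3⟩
        refine ⟨add_mem h1 k1, add_mem h2 k2, fun k => ?_⟩
        obtain ⟨a, ha, ha'⟩ := h3 k
        obtain ⟨b, hb, hb'⟩ := k3 k
        exact ⟨a + b, tendsto_add ha hb, by simpa [mul_add] using ha'.add hb'⟩
      smul_mem' := by
        rintro c Ψ ⟨h1, h2, h3⟩
        refine ⟨Submodule.smul_mem _ c h1, Submodule.smul_mem _ c h2, fun k => ?_⟩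
        obtain ⟨a, ha, ha'⟩ := h3 k
        refine ⟨c * a, tendsto_smul c ha, ?_⟩
        have := ha'.smul c
        rwa [mul_left_comm] at this }
  toFun :=
    { toFun := fun Ψ => diracAct (pts y) Ψ
      map_add' := fun Ψ Φ => diracAct_add (H1_empty_le _ Ψ.2.1) Ψ.2.2.1 (H1_empty_le _ Φ.2.1) Φ.2.2.1
      map_smul' := fun c Ψ => diracAct_smul c (H1_empty_le _ Ψ.2.1) Ψ.2.2.1 }

/-- The Dirac operator `D_β`: `ψ₂ ∈ H¹(ℝ)`, `ψ₁ ∈ H¹(ℝ \ Y)`, `[ψ₁]_{y_k} = -i β_k ψ₂(y_k)`,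
acting as the distributional Dirac operator on `ℝ \ Y`. -/
def diracBeta {n : ℕ} (y β : Fin n → ℝ) : Spinor →ₗ.[ℂ] Spinor where
  domain :=
    { carrier := {Ψ | Ψ.snd ∈ H1 ∅ ∧ Ψ.fst ∈ H1 (pts y) ∧
        ∀ k, ∃ a, HasValue Ψ.snd (y k) a ∧ HasJump Ψ.fst (y k) (-Complex.I * β k * a)}
      zero_mem' := ⟨zero_mem _, zero_mem _, fun k =>
        ⟨0, tendsto_zero, by simpa using hasJump_zero (y k)⟩⟩
      add_mem' := by
        rintro Ψ Φ ⟨h1, h2, h3⟩ ⟨k1, k2, k3⟩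
        refine ⟨add_mem h1 k1, add_mem h2 k2, fun k => ?_⟩
        obtain ⟨a, ha, ha'⟩ := h3 k
        obtain ⟨b, hb, hb'⟩ := k3 k
        exact ⟨a + b, tendsto_add ha hb, by simpa [mul_add] using ha'.add hb'⟩
      smul_mem' := by
        rintro c Ψ ⟨h1, h2, h3⟩
        refine ⟨Submodule.smul_mem _ c h1, Submodule.smul_mem _ c h2, fun k => ?_⟩
        obtain ⟨a, ha, ha'⟩ := h3 k
        refine ⟨c * a, tendsto_smul c ha, ?_⟩
        have := ha'.smul c
        rwa [mul_left_comm] at this }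
  toFun :=
    { toFun := fun Ψ => diracAct (pts y) Ψ
      map_add' := fun Ψ Φ => diracAct_add Ψ.2.2.1 (H1_empty_le _ Ψ.2.1) Φ.2.2.1 (H1_empty_le _ Φ.2.1)
      map_smul' := fun c Ψ => diracAct_smul c Ψ.2.2.1 (H1_empty_le _ Ψ.2.1) }

/-- The square `A²` of an unbounded operator, with its natural domain `{x ∈ dom A | A x ∈ dom A}`. -/
def square (A : Spinor →ₗ.[ℂ] Spinor) : Spinor →ₗ.[ℂ] Spinor :=
  A.comp (A.domRestrict ((A.domain.comap A.toFun).map A.domain.subtype)) (by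
    rintro ⟨x, hx⟩
    obtain ⟨⟨x', hx', e⟩, h⟩ := id hx
    have h' : A.domRestrict ((A.domain.comap A.toFun).map A.domain.subtype) ⟨x, hx⟩ = A x' :=
      LinearPMap.domRestrict_apply e.symm
    rw [h']
    exact hx')

theorem mem_square_domain (A : Spinor →ₗ.[ℂ] Spinor) (x : Spinor) :
    x ∈ (square A).domain ↔ ∃ h : x ∈ A.domain, A ⟨x, h⟩ ∈ A.domain := by
  constructor
  · rintro ⟨⟨x', hx', rfl⟩, h⟩
    exact ⟨h, hx'⟩
  · rintro ⟨h, h'⟩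
    exact ⟨⟨⟨x, h⟩, h', rfl⟩, h⟩

theorem square_apply (A : Spinor →ₗ.[ℂ] Spinor) (x : Spinor) (hx : x ∈ (square A).domain)
    (h : x ∈ A.domain) (h' : A ⟨x, h⟩ ∈ A.domain) :
    square A ⟨x, hx⟩ = A ⟨A ⟨x, h⟩, h'⟩ := rfl

/-- `A + 1/4`, with domain `dom A`. -/
def addQuarter (A : Spinor →ₗ.[ℂ] Spinor) : Spinor →ₗ.[ℂ] Spinor :=
  ((1 / 4 : ℂ) • (LinearMap.id : Spinor →ₗ[ℂ] Spinor)) +ᵥ A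

/-! ### The extensions labelled by couples `(Π, Θ)` -/

/-- A couple `(Π, Θ)`: `proj` is the matrix of the orthogonal projector `Π` in `ℂ^ι`, and `theta` the
matrix of the symmetric operator `Θ : ran Π → ran Π`, extended by `0` to the orthogonal complement
of `ran Π`. -/
structure Couple (ι : Type) [Fintype ι] where
  proj : Matrix ι ι ℂ
  theta : Matrix ι ι ℂ
  proj_herm : proj.IsHermitian
  proj_idem : proj * proj = proj
  theta_herm : theta.IsHermitian
  theta_eq : proj * theta * proj = theta

/-- The direct sum of couples, one for each point. -/
def Couple.directSum {n m : ℕ} (P : Fin n → Couple (Fin m)) : Couple (Fin m × Fin n) where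
  proj := Matrix.blockDiagonal fun k => (P k).proj
  theta := Matrix.blockDiagonal fun k => (P k).theta
  proj_herm := by
    rw [Matrix.IsHermitian, Matrix.blockDiagonal_conjTranspose]
    congr 1; funext k; exact (P k).proj_herm
  proj_idem := by
    rw [← Matrix.blockDiagonal_mul]
    congr 1; funext k; exact (P k).proj_idem
  theta_herm := by
    rw [Matrix.IsHermitian, Matrix.blockDiagonal_conjTranspose]
    congr 1; funext k; exact (P k).theta_herm
  theta_eq := by
    rw [← Matrix.blockDiagonal_mul, ← Matrix.blockDiagonal_mul]
    congr 1; funext k; exact (P k).theta_eq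

/-- `sgn x`, as a complex number. -/
def csgn (x : ℝ) : ℂ := (Real.sign x : ℂ)

/-- The kernel `ĝ_z(x) = e^{i√z|x|} / (2i√z)` of `(-H + z)⁻¹`, in terms of `s = √z`, `Im s > 0`. -/
def schrKer (s : ℂ) (x : ℝ) : ℂ := Complex.exp (Complex.I * s * |x|) / (2 * Complex.I * s)

/-- The derivative `ĝ_z'(x) = sgn(x) e^{i√z|x|} / 2` of `schrKer s`, where `s = √z`. -/
def schrKerDeriv (s : ℂ) (x : ℝ) : ℂ := csgn x * Complex.exp (Complex.I * s * |x|) / 2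

/-- The kernel `g_z = (D + z) ĝ_w 𝟙`, `w = z² - 1/4`, of `(-D + z)⁻¹`, with `s = √w`, `Im s > 0`. -/
def diracKer (z s : ℂ) (x : ℝ) : Matrix (Fin 2) (Fin 2) ℂ :=
  !![(1 / 2 + z) * schrKer s x, -Complex.I * schrKerDeriv s x;
     -Complex.I * schrKerDeriv s x, (-1 / 2 + z) * schrKer s x]

/-- `(G_z ξ)_j (x) = ∑_k (g_z(x - y_k) ξ_k)_j`. -/
def diracG {n : ℕ} (y : Fin n → ℝ) (z s : ℂ) (ξ : Fin 2 × Fin n → ℂ) (j : Fin 2) (x : ℝ) : ℂ :=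
  ∑ k, ∑ l, diracKer z s (x - y k) j l * ξ (l, k)

/-- `(Ĝ_z ξ)(x) = ∑_k (ĝ_z(y_k - x) ξ_{k,1} + ĝ_z'(y_k - x) ξ_{k,2})`, where `s = √z`. -/
def schrG {n : ℕ} (y : Fin n → ℝ) (s : ℂ) (ξ₁ ξ₂ : Fin n → ℂ) (x : ℝ) : ℂ :=
  ∑ k, (schrKer s (y k - x) * ξ₁ k + schrKerDeriv s (y k - x) * ξ₂ k)

/-- The graph of `D_{Π,Θ}`, written with the spectral parameter `z` (`s² = z² - 1/4`, `Im s > 0`):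
the pairs `(Ψ, D_{Π,Θ} Ψ)` where `Ψ = Ψ_z + G_z ξ` with `Ψ_z ∈ H¹(ℝ; ℂ²)`, `ξ ∈ ran Π`,
`Π τΨ = Θ ξ`, and `(-D_{Π,Θ} + z) Ψ = (-D + z) Ψ_z`. Here `v = τΨ = (⟨Ψ⟩_{y_k})_k`. -/
def diracExtGraph {n : ℕ} (y : Fin n → ℝ) (P : Couple (Fin 2 × Fin n)) (z s : ℂ) :
    Set (Spinor × Spinor) :=
  {p | ∃ (Ψz : Spinor) (ξ v : Fin 2 × Fin n → ℂ),
    Ψz.fst ∈ H1 ∅ ∧ Ψz.snd ∈ H1 ∅ ∧ P.proj *ᵥ ξ = ξ ∧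
    (∀ᵐ x, p.1.fst x = Ψz.fst x + diracG y z s ξ 0 x) ∧
    (∀ᵐ x, p.1.snd x = Ψz.snd x + diracG y z s ξ 1 x) ∧
    (∀ k, HasMean p.1.fst (y k) (v (0, k)) ∧ HasMean p.1.snd (y k) (v (1, k))) ∧
    P.proj *ᵥ v = P.theta *ᵥ ξ ∧
    -p.2 + z • p.1 = -diracAct ∅ Ψz + z • Ψz}

/-- The graph of `Ĥ_{Π̂,Θ̂}`, written with the spectral parameter `z` (`s² = z`, `Im s > 0`):
the pairs `(Ψ, Ĥ_{Π̂,Θ̂} Ψ)` where `Ψ = Ψ_z + (Ĝ_z 𝟙) ξ` with `Ψ_z ∈ H²(ℝ; ℂ²)`, `ξ ∈ ran Π̂`,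
`Π̂ (τ̂ 𝟙)Ψ = Θ̂ ξ`, and `(-Ĥ_{Π̂,Θ̂} + z) Ψ = (-H + z)𝟙 Ψ_z`. The coordinates of `ℂ^{4n}` are
grouped by points: `v = (τ̂ 𝟙)Ψ` has at `y_k` the four entries
`⟨ψ₁⟩, ⟨ψ₁'⟩, ⟨ψ₂⟩, ⟨ψ₂'⟩`. -/
def schrExtGraph {n : ℕ} (y : Fin n → ℝ) (P : Couple (Fin 4 × Fin n)) (z s : ℂ) :
    Set (Spinor × Spinor) :=
  {p | ∃ (Ψz : Spinor) (ξ v : Fin 4 × Fin n → ℂ),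
    MemH2 ∅ Ψz.fst ∧ MemH2 ∅ Ψz.snd ∧ P.proj *ᵥ ξ = ξ ∧
    (∀ᵐ x, p.1.fst x = Ψz.fst x + schrG y s (fun k => ξ (0, k)) (fun k => ξ (1, k)) x) ∧
    (∀ᵐ x, p.1.snd x = Ψz.snd x + schrG y s (fun k => ξ (2, k)) (fun k => ξ (3, k)) x) ∧
    (∀ k, HasMean p.1.fst (y k) (v (0, k)) ∧
      HasMean (weakDeriv (pts y) p.1.fst) (y k) (v (1, k)) ∧
      HasMean p.1.snd (y k) (v (2, k)) ∧
      HasMean (weakDeriv (pts y) p.1.snd) (y k) (v (3, k))) ∧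
    P.proj *ᵥ v = P.theta *ᵥ ξ ∧
    -p.2 + z • p.1 = -schrAct ∅ Ψz + z • Ψz}

/-- `A = D_{Π,Θ}` (for every admissible choice of `z`). -/
def IsDiracExtension {n : ℕ} (y : Fin n → ℝ) (P : Couple (Fin 2 × Fin n))
    (A : Spinor →ₗ.[ℂ] Spinor) : Prop :=
  ∀ z s : ℂ, s ^ 2 = z ^ 2 - 1 / 4 → 0 < s.im →
    (A.graph : Set (Spinor × Spinor)) = diracExtGraph y P z s

/-- `A = Ĥ_{Π̂,Θ̂}` (for every admissible choice of `z`). -/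
def IsSchrExtension {n : ℕ} (y : Fin n → ℝ) (P : Couple (Fin 4 × Fin n))
    (A : Spinor →ₗ.[ℂ] Spinor) : Prop :=
  ∀ z s : ℂ, s ^ 2 = z → 0 < s.im →
    (A.graph : Set (Spinor × Spinor)) = schrExtGraph y P z s

/-- `Π_k(ξ₁, ξ₂) = (ξ₁, 0)`, `Θ_k = α_k⁻¹`. -/
def coupleAlpha (a : ℝ) : Couple (Fin 2) where
  proj := !![1, 0; 0, 0]
  theta := (a : ℂ)⁻¹ • !![1, 0; 0, 0]
  proj_herm := by ext i j; fin_cases i <;> fin_cases j <;> simp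
  proj_idem := by ext i j; fin_cases i <;> fin_cases j <;> simp
  theta_herm := by ext i j; fin_cases i <;> fin_cases j <;> simp
  theta_eq := by ext i j; fin_cases i <;> fin_cases j <;> simp

/-- `Π_k(ξ₁, ξ₂) = (0, ξ₂)`, `Θ_k = β_k⁻¹`. -/
def coupleBeta (b : ℝ) : Couple (Fin 2) where
  proj := !![0, 0; 0, 1]
  theta := (b : ℂ)⁻¹ • !![0, 0; 0, 1]
  proj_herm := by ext i j; fin_cases i <;> fin_cases j <;> simp
  proj_idem := by ext i j; fin_cases i <;> fin_cases j <;> simp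
  theta_herm := by ext i j; fin_cases i <;> fin_cases j <;> simp
  theta_eq := by ext i j; fin_cases i <;> fin_cases j <;> simp

/-- `ran Π̂_k = ℂ ⊕ 0 ⊕ 0 ⊕ ℂ`, with `Θ̂_k = α_k⁻¹ [[0, -i], [i, -1]]` on it. -/
def coupleAlphaHat (a : ℝ) : Couple (Fin 4) where
  proj := Matrix.diagonal ![1, 0, 0, 1]
  theta := (a : ℂ)⁻¹ • !![0, 0, 0, -Complex.I; 0, 0, 0, 0; 0, 0, 0, 0; Complex.I, 0, 0, -1]
  proj_herm := by ext i j; fin_cases i <;> fin_cases j <;> simp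
  proj_idem := by ext i j; fin_cases i <;> fin_cases j <;> simp
  theta_herm := by ext i j; fin_cases i <;> fin_cases j <;> simp
  theta_eq := by ext i j; fin_cases i <;> fin_cases j <;> simp

/-- `ran Π̂_k = 0 ⊕ ℂ ⊕ ℂ ⊕ 0`, with `Θ̂_k = β_k⁻¹ [[1, i], [-i, 0]]` on it. -/
def coupleBetaHat (b : ℝ) : Couple (Fin 4) where
  proj := Matrix.diagonal ![0, 1, 1, 0]
  theta := (b : ℂ)⁻¹ • !![0, 0, 0, 0; 0, 1, Complex.I, 0; 0, -Complex.I, 0, 0; 0, 0, 0, 0]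
  proj_herm := by ext i j; fin_cases i <;> fin_cases j <;> simp
  proj_idem := by ext i j; fin_cases i <;> fin_cases j <;> simp
  theta_herm := by ext i j; fin_cases i <;> fin_cases j <;> simp
  theta_eq := by ext i j; fin_cases i <;> fin_cases j <;> simp

/-- The conditions defining `dom Ĥ_α`. -/
def DomAlpha {n : ℕ} (y α : Fin n → ℝ) (Ψ : Spinor) : Prop :=
  MemH2 (pts y) Ψ.fst ∧ MemH2 (pts y) Ψ.snd ∧ ∀ k,
    HasJump Ψ.fst (y k) 0 ∧ HasJump (weakDeriv (pts y) Ψ.snd) (y k) 0 ∧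
    ∃ a b, HasValue Ψ.fst (y k) a ∧ HasValue (weakDeriv (pts y) Ψ.snd) (y k) b ∧
      HasJump (weakDeriv (pts y) Ψ.fst) (y k) (α k * (a - Complex.I * b)) ∧
      HasJump Ψ.snd (y k) (-Complex.I * α k * a)

/-- The conditions defining `dom Ĥ_β`. -/
def DomBeta {n : ℕ} (y β : Fin n → ℝ) (Ψ : Spinor) : Prop :=
  MemH2 (pts y) Ψ.fst ∧ MemH2 (pts y) Ψ.snd ∧ ∀ k,
    HasJump (weakDeriv (pts y) Ψ.fst) (y k) 0 ∧ HasJump Ψ.snd (y k) 0 ∧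
    ∃ a b, HasValue Ψ.snd (y k) a ∧ HasValue (weakDeriv (pts y) Ψ.fst) (y k) b ∧
      HasJump Ψ.fst (y k) (-Complex.I * β k * a) ∧
      HasJump (weakDeriv (pts y) Ψ.snd) (y k) (-β k * (a + Complex.I * b))

end PointInt

end

/-!
Both Dirac operators are the same relation on components, `DiracRel`: one component `a` lies in
`H¹(ℝ)`, the other one, `b`, lies in `H¹(ℝ \ Y)` and jumps by `-i γ_k a(y_k)`, and the image is
`(-i b' + m a, -i a' - m b)`. The mass is `1/2` for `D_α` with `(a, b) = (ψ₁, ψ₂)` and `-1/2` for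
`D_β` with `(a, b) = (ψ₂, ψ₁)`. Everything is proved once for `DiracRel` and then read off.

*Traces.* By du Bois-Reymond's lemma (`exists_ae_eq_const`) a function in `H¹(ℝ \ S)` agrees with a
primitive of its weak derivative on every interval free of points of `S`
(`HasWeakDeriv.exists_isPrimitive`). So one-sided values exist everywhere, and a point without a
jump can be removed from `S` (`HasWeakDeriv.of_insert`). The kernel `ĝ'(· - p)` is smooth off `p`
and has a unit jump at `p`. Subtracting such kernels removes the jumps one at a time, which reduces
Green's formula (`inner_weakDeriv_add`) to a single singular point, where it is the product rule for
absolutely continuous functions.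

*Self-adjointness.* Symmetry is Green's formula, since `γ_k` is real (`DiracRel.symmetric`). An
element of the adjoint relation is tested against `(0, φ)`, against `(φ, 0)` with `φ` supported off
`Y`, and against a bump at `y_k` completed by a kernel with the right jump: this yields the weak
derivatives and the jump conditions (`DiracRel.of_adjoint`).

*The square.* For a self-adjoint `A`, von Neumann's argument, the orthogonal decomposition along the
closed graph, makes `A² + 1` surjective; a symmetric operator that is surjective after adding a real
constant is self-adjoint. Hence `A² - 1/4` is self-adjoint (`isSelfAdjoint_squareSubQuarter`). If
`(a, b) ↦ (c, d)` under the Dirac relation, the two first-order equations determine `b'` from `c`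
and `a`, and `a'` from `d` and `b`. The conditions on `(c, d)` thus become conditions on the second
derivatives and on the jumps of `a'` and `b'`, which gives the domain and the action of the square
(`diracRel_diracRel_iff`).

*Extensions.* When all `γ_k ≠ 0`, the jumps of an element of the domain are those of a superposition
of `ĝ(· - y_k)` and `ĝ'(· - y_k)` with suitable charges. Subtracting the superposition leaves an
element of `H¹(ℝ)`, respectively `H²(ℝ)`, and the coupling conditions, solved for the values at
`y_k`, become `Π v = Θ ξ` (`diracRel_iff_exists`, `schrDom_iff_exists`).
-/

noncomputable section

namespace PointInt

/-! ### Primitives of locally integrable functions -/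

/-- `F` is a primitive of the locally integrable function `f`, that is, `F` is locally absolutely
continuous with `F' = f` almost everywhere. -/
structure IsPrimitive (F f : ℝ → ℂ) : Prop where
  locallyIntegrable : LocallyIntegrable f
  sub_eq : ∀ a b, F b - F a = ∫ x in a..b, f x

theorem intervalIntegrable_of_locallyIntegrable {f : ℝ → ℂ}
    (hf : LocallyIntegrable f) (a b : ℝ) : IntervalIntegrable f volume a b :=
  intervalIntegrable_iff.mpr
    ((hf.integrableOn_isCompact isCompact_uIcc).mono_set Set.uIoc_subset_uIcc)

namespace IsPrimitive

variable {F f H h : ℝ → ℂ}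

theorem eq_add (hF : IsPrimitive F f) (a x : ℝ) : F x = F a + ∫ t in a..x, f t := by
  rw [← hF.sub_eq a x]; ring

theorem ae_hasDerivAt (hF : IsPrimitive F f) : ∀ᵐ x, HasDerivAt F (f x) x := by
  filter_upwards [_root_.LocallyIntegrable.ae_hasDerivAt_integral hF.locallyIntegrable] with x hx
  have e : F = fun x => F 0 + ∫ t in (0 : ℝ)..x, f t := funext (hF.eq_add 0)
  rw [e]
  exact (hx 0).const_add _

theorem of_locallyIntegrable (hf : LocallyIntegrable f) (a : ℝ) :
    IsPrimitive (fun x => ∫ t in a..x, f t) f where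
  locallyIntegrable := hf
  sub_eq _ _ := intervalIntegral.integral_interval_sub_left
    (intervalIntegrable_of_locallyIntegrable hf _ _)
    (intervalIntegrable_of_locallyIntegrable hf _ _)

theorem add_const (hF : IsPrimitive F f) (c : ℂ) : IsPrimitive (fun x => F x + c) f where
  locallyIntegrable := hF.locallyIntegrable
  sub_eq a b := by rw [← hF.sub_eq]; ring

theorem conj (hF : IsPrimitive F f) :
    IsPrimitive (fun x => starRingEnd ℂ (F x)) (fun x => starRingEnd ℂ (f x)) where
  locallyIntegrable := fun x => by
    obtain ⟨s, hs, hi⟩ := hF.locallyIntegrable x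
    exact ⟨s, hs, (LinearIsometryEquiv.integrable_comp_iff Complex.conjLIE (φ := f)).mpr hi⟩
  sub_eq a b := by
    rw [← map_sub, hF.sub_eq, intervalIntegral.intervalIntegral_eq_integral_uIoc,
      intervalIntegral.intervalIntegral_eq_integral_uIoc, integral_conj]
    split_ifs <;> simp

/-- A complex primitive is absolutely continuous: apply the real-valued statement to the real and
imaginary parts. -/
theorem absolutelyContinuousOnInterval (hF : IsPrimitive F f) (a b : ℝ) :
    AbsolutelyContinuousOnInterval F a b := by
  have hi := intervalIntegrable_of_locallyIntegrable hF.locallyIntegrable a b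
  have hre : IntervalIntegrable (fun x => (f x).re) volume a b := ⟨hi.1.re, hi.2.re⟩
  have him : IntervalIntegrable (fun x => (f x).im) volume a b := ⟨hi.1.im, hi.2.im⟩
  have hc (c : ℂ) : AbsolutelyContinuousOnInterval (fun _ => c) a b :=
    contDiffOn_const.absolutelyContinuousOnInterval
  have key := (hc (F a)).fun_add
    (((hre.absolutelyContinuousOnInterval_intervalIntegral Set.left_mem_uIcc).fun_smul
      (hc 1)).fun_add
    ((him.absolutelyContinuousOnInterval_intervalIntegral Set.left_mem_uIcc).fun_smul
      (hc Complex.I)))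
  refine (congrArg (AbsolutelyContinuousOnInterval · a b) (funext fun x => ?_)).mpr key
  have hx := intervalIntegrable_of_locallyIntegrable hF.locallyIntegrable a x
  rw [hF.eq_add a x]
  congr 1
  have e1 : (∫ t in a..x, f t).re = ∫ t in a..x, (f t).re :=
    (intervalIntegral.intervalIntegral_re (𝕜 := ℂ) hx).symm
  have e2 : (∫ t in a..x, f t).im = ∫ t in a..x, (f t).im :=
    (intervalIntegral.intervalIntegral_im (𝕜 := ℂ) hx).symm
  rw [← e1, ← e2]
  apply Complex.ext <;> simp

theorem continuous (hF : IsPrimitive F f) : Continuous F := by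
  rw [continuous_iff_continuousAt]
  intro x
  refine (hF.absolutelyContinuousOnInterval (x - 1) (x + 1)).continuousOn.continuousAt ?_
  rw [Set.uIcc_of_le (by linarith)]
  exact Icc_mem_nhds (by linarith) (by linarith)

/-- Product rule: integration by parts for absolutely continuous functions. -/
theorem mul (hF : IsPrimitive F f) (hH : IsPrimitive H h) :
    IsPrimitive (fun x => F x * H x) (fun x => f x * H x + F x * h x) := by
  have hl : LocallyIntegrable (fun x => f x * H x + F x * h x) := by
    rw [locallyIntegrable_iff]
    exact fun K hK => ((hF.locallyIntegrable.integrableOn_isCompact hK).mul_continuousOn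
      hH.continuous.continuousOn hK).add ((hH.locallyIntegrable.integrableOn_isCompact
        hK).continuousOn_mul hF.continuous.continuousOn hK)
  refine ⟨hl, fun a b => ?_⟩
  -- The difference of `F * H` and the primitive of `f * H + F * h` is absolutely continuous with
  -- derivative zero almost everywhere, hence constant.
  have hP := of_locallyIntegrable hl a
  have hac := ((hF.absolutelyContinuousOnInterval a b).fun_smul
    (hH.absolutelyContinuousOnInterval a b)).fun_sub (hP.absolutelyContinuousOnInterval a b)
  obtain ⟨C, hC⟩ := hac.const_of_ae_hasDerivAt_zero (by
    filter_upwards [hF.ae_hasDerivAt, hH.ae_hasDerivAt, hP.ae_hasDerivAt] with x h1 h2 h3 _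
    have := (h1.fun_mul h2).fun_sub h3
    simpa using this)
  have ea := hC a Set.left_mem_uIcc
  have eb := hC b Set.right_mem_uIcc
  simp only [smul_eq_mul, intervalIntegral.integral_same, sub_zero] at ea eb
  rw [ea, ← eb]; ring

/-- On a right half-line, an integrable primitive vanishes at infinity. -/
theorem integral_Ioi (hF : IsPrimitive F f) (y : ℝ) (h1 : IntegrableOn F (Set.Ioi y))
    (h2 : IntegrableOn f (Set.Ioi y)) : ∫ x in Set.Ioi y, f x = -F y := by
  have ht := intervalIntegral_tendsto_integral_Ioi y h2 tendsto_id
  have hF' : Tendsto F atTop (𝓝 (F y + ∫ x in Set.Ioi y, f x)) :=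
    (ht.const_add (F y)).congr fun x => (hF.eq_add y x).symm
  -- The limit of `F` at `+∞` exists; it is zero because `F` is integrable there.
  have hz : F y + ∫ x in Set.Ioi y, f x = 0 := by
    refine IntegrableAtFilter.eq_zero_of_tendsto (μ := volume) ⟨Set.Ioi y, Ioi_mem_atTop y, h1⟩
      (fun s hs => ?_) hF'
    obtain ⟨b, hb⟩ := mem_atTop_sets.mp hs
    exact top_le_iff.mp ((Real.volume_Ici (a := b)).symm.le.trans (measure_mono hb))
  exact (neg_eq_of_add_eq_zero_right hz).symm

/-- On a left half-line, an integrable primitive vanishes at infinity. -/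
theorem integral_Iio (hF : IsPrimitive F f) (y : ℝ) (h1 : IntegrableOn F (Set.Iio y))
    (h2 : IntegrableOn f (Set.Iio y)) : ∫ x in Set.Iio y, f x = F y := by
  rw [← integrableOn_Iic_iff_integrableOn_Iio] at h2
  rw [← integral_Iic_eq_integral_Iio]
  have ht := intervalIntegral_tendsto_integral_Iic y h2 tendsto_id
  have hF' : Tendsto F atBot (𝓝 (F y - ∫ x in Set.Iic y, f x)) :=
    (ht.const_sub (F y)).congr fun x => by rw [id, ← hF.sub_eq x y]; ring
  have hz : F y - ∫ x in Set.Iic y, f x = 0 := by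
    refine IntegrableAtFilter.eq_zero_of_tendsto (μ := volume) ⟨Set.Iio y, Iio_mem_atBot y, h1⟩
      (fun s hs => ?_) hF'
    obtain ⟨b, hb⟩ := mem_atBot_sets.mp hs
    exact top_le_iff.mp ((Real.volume_Iic (a := b)).symm.le.trans (measure_mono hb))
  exact (sub_eq_zero.mp hz).symm

theorem of_contDiff {φ : ℝ → ℝ} (hφ : ContDiff ℝ 1 φ) :
    IsPrimitive (fun x => (φ x : ℂ)) (fun x => ((deriv φ x : ℝ) : ℂ)) where
  locallyIntegrable :=
    (Complex.continuous_ofReal.comp (hφ.continuous_deriv le_rfl)).locallyIntegrable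
  sub_eq a b := by
    rw [intervalIntegral.integral_ofReal, intervalIntegral.integral_deriv_eq_sub]
    · simp
    · exact fun x _ => (hφ.differentiable one_ne_zero).differentiableAt
    · exact (hφ.continuous_deriv le_rfl).intervalIntegrable _ _

/-- Integration by parts against a test function. -/
theorem integral_deriv_smul (hF : IsPrimitive F f) {φ : ℝ → ℝ} (hφ : ContDiff ℝ ∞ φ)
    (hc : HasCompactSupport φ) : ∫ x, deriv φ x • F x = -∫ x, φ x • f x := by
  have h1 : ContDiff ℝ 1 φ := hφ.of_le (by simp)
  have hP := (of_contDiff h1).mul hF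
  have i1 : Integrable fun x => ((deriv φ x : ℝ) : ℂ) * F x := by
    have := hF.continuous.locallyIntegrable.integrable_smul_left_of_hasCompactSupport
      (h1.continuous_deriv le_rfl) hc.deriv (μ := volume)
    simpa using this
  have i2 : Integrable fun x => (φ x : ℂ) * f x := by
    have := hF.locallyIntegrable.integrable_smul_left_of_hasCompactSupport h1.continuous hc
    simpa using this
  have i3 : Integrable fun x => (φ x : ℂ) * F x := by
    have := hF.continuous.locallyIntegrable.integrable_smul_left_of_hasCompactSupport
      h1.continuous hc (μ := volume)
    simpa using this
  have e := hP.integral_Ioi 0 i3.integrableOn (i1.add i2).integrableOn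
  have e' := hP.integral_Iio 0 i3.integrableOn (i1.add i2).integrableOn
  have key : ∫ x, (((deriv φ x : ℝ) : ℂ) * F x + (φ x : ℂ) * f x) = 0 := by
    have := intervalIntegral.integral_Iic_add_Ioi (b := 0) (i1.add i2).integrableOn
      (i1.add i2).integrableOn
    rw [integral_Iic_eq_integral_Iio] at this
    refine this.symm.trans ?_
    simp only [Pi.add_apply]
    rw [e, e']; ring
  rw [integral_add i1 i2] at key
  simpa using eq_neg_of_add_eq_zero_left key

end IsPrimitive

/-! ### Local representation of Sobolev functions and one-sided traces -/

/-- A test function of vanishing integral, supported in an interval `J`, is the derivative of a test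
function supported in `J`. -/
theorem exists_test_antideriv {J : Set ℝ} [J.OrdConnected] {φ : ℝ → ℝ} (h1 : ContDiff ℝ ∞ φ)
    (h2 : HasCompactSupport φ) (h3 : tsupport φ ⊆ J) (h4 : ∫ x, φ x = 0) :
    ∃ ψ : ℝ → ℝ, ContDiff ℝ ∞ ψ ∧ HasCompactSupport ψ ∧ tsupport ψ ⊆ J ∧ deriv ψ = φ := by
  obtain ⟨a, b, hab, hJ⟩ : ∃ a b : ℝ, Function.support φ ⊆ Set.Icc a b ∧ Set.Icc a b ⊆ J := by
    rcases (tsupport φ).eq_empty_or_nonempty with h | h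
    -- For `φ = 0` any empty interval will do.
    · exact ⟨1, 0, (subset_tsupport φ).trans (by simp [h]), by simp⟩
    · have hK : IsCompact (tsupport φ) := h2
      refine ⟨sInf (tsupport φ), sSup (tsupport φ), fun x hx => ?_, ?_⟩
      · exact ⟨csInf_le hK.bddBelow (subset_tsupport φ hx), le_csSup hK.bddAbove
          (subset_tsupport φ hx)⟩
      · exact Set.Icc_subset J (h3 (hK.sInf_mem h)) (h3 (hK.sSup_mem h))
  have hi : Integrable φ := h1.continuous.integrable_of_hasCompactSupport h2
  have hd : ∀ x, HasDerivAt (fun x => ∫ t in a..x, φ t) (φ x) x := fun x =>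
    intervalIntegral.integral_hasDerivAt_right (hi.intervalIntegrable)
      (h1.continuous.stronglyMeasurableAtFilter _ _) h1.continuous.continuousAt
  have hde : deriv (fun x => ∫ t in a..x, φ t) = φ := funext fun x => (hd x).deriv
  have hsupp : Function.support (fun x => ∫ t in a..x, φ t) ⊆ Set.Icc a b := by
    intro x hx
    by_contra hx'
    apply hx
    rcases lt_or_ge x a with hxa | hxa
    · apply intervalIntegral.integral_zero_ae
      filter_upwards [Measure.ae_ne volume a] with t hta ht
      rw [Set.uIoc_of_ge hxa.le] at ht
      by_contra h0
      exact hta (le_antisymm ht.2 (hab h0).1)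
    · have hxb : b < x := not_le.mp fun h => hx' ⟨hxa, h⟩
      change ∫ t in a..x, φ t = 0
      rw [intervalIntegral.integral_of_le hxa, ← h4, ← integral_Icc_eq_integral_Ioc]
      exact setIntegral_eq_integral_of_forall_compl_eq_zero fun t ht => by
        by_contra h0
        exact ht ⟨(hab h0).1, (hab h0).2.trans hxb.le⟩
  have hts := closure_minimal hsupp isClosed_Icc
  refine ⟨_, ?_, HasCompactSupport.of_support_subset_isCompact isCompact_Icc hsupp,
    hts.trans hJ, hde⟩
  rw [contDiff_infty_iff_deriv, hde]
  exact ⟨fun x => (hd x).differentiableAt, h1⟩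

/-- du Bois-Reymond: a locally integrable function with zero distributional derivative on an open
interval is almost everywhere constant there. -/
theorem exists_ae_eq_const {J : Set ℝ} (hJ : IsOpen J) [J.OrdConnected] {u : ℝ → ℂ}
    (hu : LocallyIntegrable u)
    (h : ∀ φ : ℝ → ℝ, ContDiff ℝ ∞ φ → HasCompactSupport φ → tsupport φ ⊆ J →
      ∫ x, deriv φ x • u x = 0) : ∃ c : ℂ, ∀ᵐ x, x ∈ J → u x = c := by
  rcases J.eq_empty_or_nonempty with rfl | ⟨p, hp⟩
  · exact ⟨0, by simp⟩
  obtain ⟨ε, hε, hball⟩ := Metric.nhds_basis_closedBall.mem_iff.mp (hJ.mem_nhds hp)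
  let θ : ContDiffBump p := ⟨ε / 2, ε, by positivity, by linarith⟩
  -- For a test function `φ`, the function `φ - (∫ φ) ρ` has integral zero, hence is the derivative
  -- of a test function; so `∫ φ u = (∫ φ) (∫ ρ u)`, and the constant is `∫ ρ u`.
  set ρ : ℝ → ℝ := θ.normed volume
  have hρ1 : ContDiff ℝ ∞ ρ := θ.contDiff_normed
  have hρ2 : HasCompactSupport ρ := θ.hasCompactSupport_normed
  have hρ3 : tsupport ρ ⊆ J := by rw [θ.tsupport_normed_eq]; exact hball
  refine ⟨∫ x, ρ x • u x, ?_⟩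
  have hl : LocallyIntegrable (fun x => u x - ∫ x, ρ x • u x) := hu.sub (locallyIntegrable_const _)
  have key := hJ.ae_eq_zero_of_integral_contDiff_smul_eq_zero (hl.locallyIntegrableOn J)
    (fun φ h1 h2 h3 => ?_)
  · filter_upwards [key] with x hx hxJ using sub_eq_zero.mp (hx hxJ)
  have hi (χ : ℝ → ℝ) (k1 : ContDiff ℝ ∞ χ) (k2 : HasCompactSupport χ) :
      Integrable (fun x => χ x • u x) :=
    hu.integrable_smul_left_of_hasCompactSupport k1.continuous k2
  have hφi : Integrable φ := h1.continuous.integrable_of_hasCompactSupport h2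
  have hρi : Integrable ρ := hρ1.continuous.integrable_of_hasCompactSupport hρ2
  have d1 : ContDiff ℝ ∞ (fun x => φ x - (∫ t, φ t) * ρ x) := h1.sub (contDiff_const.mul hρ1)
  have d2 : HasCompactSupport (fun x => φ x - (∫ t, φ t) * ρ x) := h2.sub hρ2.mul_left
  have d3 : tsupport (fun x => φ x - (∫ t, φ t) * ρ x) ⊆ J :=
    (tsupport_sub _ _).trans (Set.union_subset h3 ((tsupport_mul_subset_right).trans hρ3))
  have d4 : ∫ x, (φ x - (∫ t, φ t) * ρ x) = 0 := by
    rw [integral_sub hφi (hρi.const_mul _), integral_const_mul, θ.integral_normed]; ring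
  obtain ⟨ψ, e1, e2, e3, e4⟩ := exists_test_antideriv d1 d2 d3 d4
  have e := h ψ e1 e2 e3
  simp only [e4, sub_smul] at e
  rw [integral_sub (hi φ h1 h2)
    (by simp only [mul_smul]; exact (hi ρ hρ1 hρ2).smul (∫ t, φ t))] at e
  simp only [mul_smul] at e
  rw [integral_smul] at e
  simp only [smul_sub]
  rw [integral_sub (hi φ h1 h2) (hφi.smul_const _), integral_smul_const]
  exact e

theorem locallyIntegrable_L2 (f : L2) : LocallyIntegrable (f : ℝ → ℂ) :=
  (Lp.memLp f).locallyIntegrable (by norm_num)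

/-- On an open interval free of points of `S`, a function in `H¹(ℝ \ S)` agrees almost everywhere
with a primitive of its weak derivative. -/
theorem HasWeakDeriv.exists_isPrimitive {S : Finset ℝ} {f g : L2} (hfg : HasWeakDeriv S f g)
    {J : Set ℝ} (hJ : IsOpen J) [J.OrdConnected] (hJS : ∀ x ∈ S, x ∉ J) :
    ∃ F : ℝ → ℂ, IsPrimitive F g ∧ ∀ᵐ x, x ∈ J → f x = F x := by
  have hG := IsPrimitive.of_locallyIntegrable (locallyIntegrable_L2 g) 0
  obtain ⟨c, hc⟩ := exists_ae_eq_const hJ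
    ((locallyIntegrable_L2 f).sub hG.continuous.locallyIntegrable) (fun φ h1 h2 h3 => by
      have hd : Continuous (deriv φ) := h1.continuous_deriv (by simp)
      simp only [Pi.sub_apply, smul_sub]
      rw [integral_sub (integrable_smul_L2 hd h2.deriv f)
        (hG.continuous.locallyIntegrable.integrable_smul_left_of_hasCompactSupport hd h2.deriv),
        hfg φ h1 h2 (fun x hx hxS => hJS x hxS (h3 hx)), hG.integral_deriv_smul h1 h2, sub_self])
  refine ⟨_, hG.add_const c, ?_⟩
  filter_upwards [hc] with x hx hxJ
  rw [← hx hxJ]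
  simp

theorem exists_Ioo_right_disjoint (S : Finset ℝ) (y : ℝ) :
    ∃ b, y < b ∧ ∀ x ∈ S, x ∉ Set.Ioo y b := by
  have h : ((S.erase y : Finset ℝ) : Set ℝ)ᶜ ∈ 𝓝 y :=
    (S.erase y).finite_toSet.isClosed.isOpen_compl.mem_nhds (by simp)
  obtain ⟨ε, hε, hb⟩ := Metric.mem_nhds_iff.mp h
  refine ⟨y + ε, by linarith, fun x hx hxI => ?_⟩
  refine hb (a := x) ?_ (by simpa [hx] using hxI.1.ne')
  rw [Real.ball_eq_Ioo]; exact ⟨by linarith [hxI.1], hxI.2⟩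

theorem exists_Ioo_left_disjoint (S : Finset ℝ) (y : ℝ) :
    ∃ b, b < y ∧ ∀ x ∈ S, x ∉ Set.Ioo b y := by
  have h : ((S.erase y : Finset ℝ) : Set ℝ)ᶜ ∈ 𝓝 y :=
    (S.erase y).finite_toSet.isClosed.isOpen_compl.mem_nhds (by simp)
  obtain ⟨ε, hε, hb⟩ := Metric.mem_nhds_iff.mp h
  refine ⟨y - ε, by linarith, fun x hx hxI => ?_⟩
  refine hb (a := x) ?_ (by simpa [hx] using hxI.2.ne)
  rw [Real.ball_eq_Ioo]; exact ⟨hxI.1, by linarith [hxI.2]⟩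

/-- The essential limit along `𝓝[s] y` of a function that agrees a.e. on `J` with a continuous
one. -/
theorem tendsto_of_ae_eq {f F : ℝ → ℂ} {J s : Set ℝ} {y : ℝ} (hF : Continuous F)
    (h : ∀ᵐ x, x ∈ J → f x = F x) (hJ : J ∈ 𝓝[s] y) :
    Tendsto f (𝓝[s] y ⊓ ae volume) (𝓝 (F y)) := by
  have h1 : Tendsto F (𝓝[s] y ⊓ ae volume) (𝓝 (F y)) :=
    hF.continuousAt.tendsto.mono_left (inf_le_left.trans nhdsWithin_le_nhds)
  refine h1.congr' ?_
  filter_upwards [mem_inf_of_left hJ, mem_inf_of_right h] with x hx h2 using (h2 hx).symm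

theorem exists_hasRightValue {S : Finset ℝ} {f : L2} (hf : f ∈ H1 S) (y : ℝ) :
    ∃ r, HasRightValue f y r := by
  obtain ⟨g, hg⟩ := hf
  obtain ⟨b, hb, hS⟩ := exists_Ioo_right_disjoint S y
  obtain ⟨F, hF, h⟩ := hg.exists_isPrimitive isOpen_Ioo hS
  exact ⟨F y, tendsto_of_ae_eq hF.continuous h (Ioo_mem_nhdsGT hb)⟩

theorem exists_hasLeftValue {S : Finset ℝ} {f : L2} (hf : f ∈ H1 S) (y : ℝ) :
    ∃ l, HasLeftValue f y l := by
  obtain ⟨g, hg⟩ := hf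
  obtain ⟨b, hb, hS⟩ := exists_Ioo_left_disjoint S y
  obtain ⟨F, hF, h⟩ := hg.exists_isPrimitive isOpen_Ioo hS
  exact ⟨F y, tendsto_of_ae_eq hF.continuous h (Ioo_mem_nhdsLT hb)⟩

instance nhdsLT_inf_ae_neBot (y : ℝ) : (𝓝[<] y ⊓ ae (volume : Measure ℝ)).NeBot := by
  rw [inf_neBot_iff]
  intro s hs t ht
  obtain ⟨b, hb, hbs⟩ := (mem_nhdsLT_iff_exists_Ioo_subset).mp hs
  by_contra hne
  have h0 : volume (Set.Ioo b y) = 0 := measure_mono_null (fun x hx ht => hne ⟨x, hbs hx, ht⟩) ht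
  rw [Real.volume_Ioo] at h0
  simp at h0
  exact absurd hb (not_lt.mpr h0)

instance nhdsGT_inf_ae_neBot (y : ℝ) : (𝓝[>] y ⊓ ae (volume : Measure ℝ)).NeBot := by
  rw [inf_neBot_iff]
  intro s hs t ht
  obtain ⟨b, hb, hbs⟩ := (mem_nhdsGT_iff_exists_Ioo_subset).mp hs
  by_contra hne
  have h0 : volume (Set.Ioo y b) = 0 := measure_mono_null (fun x hx ht => hne ⟨x, hbs hx, ht⟩) ht
  rw [Real.volume_Ioo] at h0
  simp at h0
  exact absurd hb (not_lt.mpr h0)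

theorem HasLeftValue.unique {f : L2} {y : ℝ} {a b : ℂ} (h : HasLeftValue f y a)
    (h' : HasLeftValue f y b) : a = b := tendsto_nhds_unique h h'

theorem HasRightValue.unique {f : L2} {y : ℝ} {a b : ℂ} (h : HasRightValue f y a)
    (h' : HasRightValue f y b) : a = b := tendsto_nhds_unique h h'

theorem HasValue.left {f : L2} {y : ℝ} {a : ℂ} (h : HasValue f y a) : HasLeftValue f y a :=
  h.mono_left (inf_le_inf_right _ nhdsWithin_le_nhds)

theorem HasValue.right {f : L2} {y : ℝ} {a : ℂ} (h : HasValue f y a) : HasRightValue f y a :=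
  h.mono_left (inf_le_inf_right _ nhdsWithin_le_nhds)

theorem HasValue.unique {f : L2} {y : ℝ} {a b : ℂ} (h : HasValue f y a)
    (h' : HasValue f y b) : a = b := h.left.unique h'.left

theorem hasValue_of_left_of_right {f : L2} {y : ℝ} {a : ℂ} (h : HasLeftValue f y a)
    (h' : HasRightValue f y a) : HasValue f y a := by
  have hle : 𝓝 y ⊓ ae (volume : Measure ℝ) ≤
      (𝓝[<] y ⊓ ae volume) ⊔ (𝓝[>] y ⊓ ae volume) := by
    rw [← inf_sup_right, nhdsLT_sup_nhdsGT, nhdsWithin, inf_assoc]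
    refine le_inf inf_le_left (le_inf (le_principal_iff.mpr ?_) inf_le_right)
    exact mem_inf_of_right (Measure.ae_ne volume y)
  exact (h.sup h').mono_left hle

theorem HasValue.hasJump {f : L2} {y : ℝ} {a : ℂ} (h : HasValue f y a) : HasJump f y 0 :=
  ⟨a, a, h.left, h.right, sub_self a⟩

theorem HasValue.hasMean {f : L2} {y : ℝ} {a : ℂ} (h : HasValue f y a) : HasMean f y a :=
  ⟨a, a, h.left, h.right, by ring⟩

theorem HasJump.unique {f : L2} {y : ℝ} {a b : ℂ} (h : HasJump f y a)
    (h' : HasJump f y b) : a = b := by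
  obtain ⟨l, r, h1, h2, rfl⟩ := h
  obtain ⟨l', r', h1', h2', rfl⟩ := h'
  rw [h1.unique h1', h2.unique h2']

theorem HasMean.unique {f : L2} {y : ℝ} {a b : ℂ} (h : HasMean f y a)
    (h' : HasMean f y b) : a = b := by
  obtain ⟨l, r, h1, h2, rfl⟩ := h
  obtain ⟨l', r', h1', h2', rfl⟩ := h'
  rw [h1.unique h1', h2.unique h2']

theorem HasJump.exists_hasValue {f : L2} {y : ℝ} (h : HasJump f y 0) : ∃ a, HasValue f y a := by
  obtain ⟨l, r, h1, h2, h0⟩ := h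
  obtain rfl := sub_eq_zero.mp h0
  exact ⟨_, hasValue_of_left_of_right h1 h2⟩

theorem exists_hasJump {S : Finset ℝ} {f : L2} (hf : f ∈ H1 S) (y : ℝ) : ∃ c, HasJump f y c := by
  obtain ⟨l, hl⟩ := exists_hasLeftValue hf y
  obtain ⟨r, hr⟩ := exists_hasRightValue hf y
  exact ⟨_, l, r, hl, hr, rfl⟩

/-- Functions in `H¹(ℝ \ S)` are continuous off `S`. -/
theorem exists_hasValue {S : Finset ℝ} {f : L2} (hf : f ∈ H1 S) {y : ℝ} (hy : y ∉ S) :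
    ∃ a, HasValue f y a := by
  obtain ⟨g, hg⟩ := hf
  obtain ⟨ε, hε, hb⟩ := Metric.mem_nhds_iff.mp
    (S.finite_toSet.isClosed.isOpen_compl.mem_nhds (show y ∈ (S : Set ℝ)ᶜ from hy))
  rw [Real.ball_eq_Ioo] at hb
  obtain ⟨F, hF, h⟩ := hg.exists_isPrimitive isOpen_Ioo fun x hx hxI => hb hxI hx
  have := tendsto_of_ae_eq (s := Set.univ) (y := y) hF.continuous h
    (by rw [nhdsWithin_univ]; exact Ioo_mem_nhds (by linarith) (by linarith))
  rw [nhdsWithin_univ] at this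
  exact ⟨F y, this⟩

/-- Removal of a point where the function is continuous: near that point the two local primitives
match. -/
theorem HasWeakDeriv.of_insert {S : Finset ℝ} {f g : L2} {y : ℝ}
    (hfg : HasWeakDeriv (insert y S) f g) {a : ℂ} (ha : HasValue f y a) : HasWeakDeriv S f g := by
  by_cases hyS : y ∈ S
  · rwa [Finset.insert_eq_of_mem hyS] at hfg
  obtain ⟨p, hp, hpS⟩ := exists_Ioo_left_disjoint (insert y S) y
  obtain ⟨q, hq, hqS⟩ := exists_Ioo_right_disjoint (insert y S) y
  obtain ⟨F, hF, hfF⟩ := hfg.exists_isPrimitive isOpen_Ioo hpS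
  obtain ⟨G, hG, hfG⟩ := hfg.exists_isPrimitive isOpen_Ioo hqS
  have e1 : F y = a := HasLeftValue.unique (f := f)
    (tendsto_of_ae_eq hF.continuous hfF (Ioo_mem_nhdsLT hp)) ha.left
  have e2 : G y = a := HasRightValue.unique (f := f)
    (tendsto_of_ae_eq hG.continuous hfG (Ioo_mem_nhdsGT hq)) ha.right
  have hGF : ∀ x, G x = F x := fun x => by rw [hG.eq_add y, hF.eq_add y, e1, e2]
  have hfF' : ∀ᵐ x, x ∈ Set.Ioo p q → f x = F x := by
    filter_upwards [hfF, hfG, Measure.ae_ne volume y] with x h1 h2 hxy hx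
    rcases lt_or_gt_of_ne hxy with h | h
    · exact h1 ⟨hx.1, h⟩
    · rw [h2 ⟨h, hx.2⟩, hGF]
  obtain ⟨ε, hε, hball⟩ := Metric.nhds_basis_closedBall.mem_iff.mp (Ioo_mem_nhds hp hq)
  let θ : ContDiffBump y := ⟨ε / 2, ε, by positivity, by linarith⟩
  have hθ : ContDiff ℝ ∞ θ := θ.contDiff
  have hθs : tsupport θ ⊆ Set.Ioo p q := by rw [θ.tsupport_eq]; exact hball
  -- Split `φ = θ φ + (1 - θ) φ`: the first part lives where `F` represents `f`, the second one is
  -- supported off `insert y S`.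
  intro φ h1 h2 h3
  have c1 : ContDiff ℝ ∞ (fun x => θ x * φ x) := hθ.mul h1
  have c2 : HasCompactSupport (fun x => θ x * φ x) := h2.mul_left
  have d1 : ContDiff ℝ ∞ (fun x => (1 - θ x) * φ x) := (contDiff_const.sub hθ).mul h1
  have d2 : HasCompactSupport (fun x => (1 - θ x) * φ x) := h2.mul_left
  have d3 : tsupport (fun x => (1 - θ x) * φ x) ⊆ ((insert y S : Finset ℝ) : Set ℝ)ᶜ := by
    intro x hx hxS
    rw [Finset.coe_insert] at hxS
    rcases hxS with rfl | hxS
    · refine (notMem_tsupport_iff_eventuallyEq.mpr ?_) hx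
      filter_upwards [θ.eventuallyEq_one] with t ht
      simp [ht]
    · exact h3 (tsupport_mul_subset_right hx) hxS
  have k1 : ∫ x, deriv (fun x => θ x * φ x) x • f x = -∫ x, (θ x * φ x) • g x := by
    rw [← hF.integral_deriv_smul c1 c2]
    apply integral_congr_ae
    filter_upwards [hfF'] with x hx
    by_cases hxI : x ∈ Set.Ioo p q
    · rw [hx hxI]
    · have : x ∉ tsupport (fun x => θ x * φ x) := fun h => hxI (hθs (tsupport_mul_subset_left h))
      have h0 : deriv (fun x => θ x * φ x) x = 0 := by
        by_contra h
        exact this (support_deriv_subset h)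
      rw [h0, zero_smul, zero_smul]
  have k2 := hfg _ d1 d2 d3
  have hd : ∀ x, deriv φ x = deriv (fun x => θ x * φ x) x + deriv (fun x => (1 - θ x) * φ x) x := by
    intro x
    rw [← deriv_fun_add (c1.differentiable (by simp) x) (d1.differentiable (by simp) x)]
    congr 1; funext t; ring
  have hv : ∀ x, φ x = θ x * φ x + (1 - θ x) * φ x := fun x => by ring
  calc ∫ x, deriv φ x • f x
      = ∫ x, (deriv (fun x => θ x * φ x) x • f x + deriv (fun x => (1 - θ x) * φ x) x • f x) := by
        simp only [hd, add_smul]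
    _ = -∫ x, ((θ x * φ x) • g x + ((1 - θ x) * φ x) • g x) := by
        rw [integral_add (integrable_smul_L2 (c1.continuous_deriv (by simp)) c2.deriv f)
          (integrable_smul_L2 (d1.continuous_deriv (by simp)) d2.deriv f), k1, k2,
          integral_add (integrable_smul_L2 c1.continuous c2 g)
          (integrable_smul_L2 d1.continuous d2 g)]
        ring
    _ = -∫ x, φ x • g x := by
        simp only [← add_smul, ← hv]

theorem HasWeakDeriv.mono {S T : Finset ℝ} (hST : S ⊆ T) {f g : L2} (h : HasWeakDeriv S f g) :
    HasWeakDeriv T f g := fun φ h1 h2 h3 =>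
  h φ h1 h2 (h3.trans (Set.compl_subset_compl.mpr (Finset.coe_subset.mpr hST)))

theorem HasWeakDeriv.of_hasJump_zero {S : Finset ℝ} {f g : L2} (hfg : HasWeakDeriv S f g)
    (h0 : ∀ y ∈ S, HasJump f y 0) : HasWeakDeriv ∅ f g := by
  induction S using Finset.induction_on with
  | empty => exact hfg
  | insert y S _ ih =>
    obtain ⟨a, ha⟩ := (h0 y (Finset.mem_insert_self y S)).exists_hasValue
    exact ih (hfg.of_insert ha) fun x hx => h0 x (Finset.mem_insert_of_mem hx)

theorem HasWeakDeriv.weakDeriv_eq {S : Finset ℝ} {f g : L2} (h : HasWeakDeriv S f g) :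
    weakDeriv S f = g := (hasWeakDeriv_weakDeriv ⟨g, h⟩).unique h

theorem HasWeakDeriv.mem_H1 {S : Finset ℝ} {f g : L2} (h : HasWeakDeriv S f g) : f ∈ H1 S := ⟨g, h⟩

theorem weakDeriv_of_mem_H1_empty {S : Finset ℝ} {f : L2} (hf : f ∈ H1 ∅) :
    weakDeriv S f = weakDeriv ∅ f :=
  ((hasWeakDeriv_weakDeriv hf).mono (Finset.empty_subset S)).weakDeriv_eq

theorem mem_H1_empty_of_hasJump {S : Finset ℝ} {f : L2} (hf : f ∈ H1 S)
    (h0 : ∀ y ∈ S, HasJump f y 0) : f ∈ H1 ∅ :=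
  ((hasWeakDeriv_weakDeriv hf).of_hasJump_zero h0).mem_H1

/-! ### The resolvent kernels as Sobolev functions -/

/-- A square integrable function with a square integrable pointwise derivative off the finite set
`S` belongs to `H¹(ℝ \ S)`: the product with a test function supported off `S` is differentiable
everywhere. -/
theorem hasWeakDeriv_of_hasDerivAt {S : Finset ℝ} {f g : L2} {F G : ℝ → ℂ} (hf : f =ᵐ[volume] F)
    (hg : g =ᵐ[volume] G) (hd : ∀ x ∉ S, HasDerivAt F (G x) x) : HasWeakDeriv S f g := by
  intro φ h1 h2 h3
  have i1 : Integrable fun x => deriv φ x • F x :=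
    (integrable_smul_L2 (h1.continuous_deriv (by simp)) h2.deriv f).congr
      (by filter_upwards [hf] with x hx; rw [hx])
  have i2 : Integrable fun x => φ x • G x :=
    (integrable_smul_L2 h1.continuous h2 g).congr (by filter_upwards [hg] with x hx; rw [hx])
  have i3 : Integrable fun x => φ x • F x :=
    (integrable_smul_L2 h1.continuous h2 f).congr (by filter_upwards [hf] with x hx; rw [hx])
  have hder : ∀ x, HasDerivAt (fun x => φ x • F x) (deriv φ x • F x + φ x • G x) x := by
    intro x
    by_cases hx : x ∈ S
    · have hx' : x ∉ tsupport φ := fun h => h3 h hx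
      have h0 : φ =ᶠ[𝓝 x] 0 := notMem_tsupport_iff_eventuallyEq.mp hx'
      have e1 : φ x = 0 := h0.self_of_nhds
      have e2 : deriv φ x = 0 := by rw [h0.deriv_eq]; simp
      rw [e1, e2, zero_smul, zero_smul, add_zero]
      exact (hasDerivAt_const x (0 : ℂ)).congr_of_eventuallyEq
        (by filter_upwards [h0] with t ht; simp [ht])
    · have := ((h1.differentiable (by simp) x).hasDerivAt).smul (hd x hx)
      rwa [add_comm] at this
  have key := integral_eq_zero_of_hasDerivAt_of_integrable hder (i1.add i2) i3
  rw [integral_add i1 i2] at key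
  rw [integral_congr_ae (show (fun x => deriv φ x • f x) =ᵐ[volume] fun x => deriv φ x • F x by
      filter_upwards [hf] with x hx; rw [hx]),
    integral_congr_ae (show (fun x => φ x • g x) =ᵐ[volume] fun x => φ x • G x by
      filter_upwards [hg] with x hx; rw [hx])]
  exact eq_neg_of_add_eq_zero_left key

theorem norm_exp_I_mul (s : ℂ) (t : ℝ) :
    ‖Complex.exp (Complex.I * s * t)‖ = Real.exp (-s.im * t) := by
  rw [Complex.norm_exp]; simp

theorem memLp_exp_abs {s : ℂ} (hs : 0 < s.im) (p : ℝ) :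
    MemLp (fun x : ℝ => Complex.exp (Complex.I * s * (|x - p| : ℝ))) 2 volume := by
  have hc : Continuous fun x : ℝ => Complex.exp (Complex.I * s * (|x - p| : ℝ)) := by fun_prop
  rw [memLp_two_iff_integrable_sq_norm hc.aestronglyMeasurable]
  simp only [norm_exp_I_mul, ← Real.exp_nat_mul]
  have h0 : Integrable fun x : ℝ => Real.exp ((2 : ℕ) * (-s.im * |x|)) := by
    rw [← integrableOn_univ, ← Set.Iic_union_Ioi (a := (0 : ℝ))]
    refine IntegrableOn.union ?_ ?_
    · refine (integrableOn_exp_mul_Iic (a := 2 * s.im) (by linarith) 0).congr_fun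
        (fun x hx => ?_) measurableSet_Iic
      simp only [Set.mem_Iic] at hx
      simp only [abs_of_nonpos hx]; congr 1; push_cast; ring
    · refine (integrableOn_exp_mul_Ioi (a := -(2 * s.im)) (by linarith) 0).congr_fun
        (fun x hx => ?_) measurableSet_Ioi
      simp only [Set.mem_Ioi] at hx
      simp only [abs_of_pos hx]; congr 1; push_cast; ring
  exact h0.comp_sub_right p

theorem csgn_of_pos {x : ℝ} (hx : 0 < x) : csgn x = 1 := by simp [csgn, Real.sign_of_pos hx]

theorem csgn_of_neg {x : ℝ} (hx : x < 0) : csgn x = -1 := by simp [csgn, Real.sign_of_neg hx]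

theorem csgn_neg (x : ℝ) : csgn (-x) = -csgn x := by simp [csgn, Real.sign_neg]

theorem schrKer_neg (s : ℂ) (x : ℝ) : schrKer s (-x) = schrKer s x := by simp [schrKer]

theorem schrKerDeriv_neg (s : ℂ) (x : ℝ) : schrKerDeriv s (-x) = -schrKerDeriv s x := by
  simp [schrKerDeriv, csgn_neg, neg_div]

theorem measurable_csgn : Measurable csgn := by
  unfold csgn Real.sign
  refine Complex.measurable_ofReal.comp ?_
  exact Measurable.ite measurableSet_Iio measurable_const
    (Measurable.ite measurableSet_Ioi measurable_const measurable_const)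

theorem norm_csgn_le (x : ℝ) : ‖csgn x‖ ≤ 1 := by
  rcases Real.sign_apply_eq x with h | h | h <;> simp [csgn, h]

theorem memLp_schrKer {s : ℂ} (hs : 0 < s.im) (p : ℝ) :
    MemLp (fun x => schrKer s (x - p)) 2 volume := by
  have := (memLp_exp_abs hs p).mul_const (2 * Complex.I * s)⁻¹
  simpa only [schrKer, div_eq_mul_inv] using this

theorem memLp_schrKerDeriv {s : ℂ} (hs : 0 < s.im) (p : ℝ) :
    MemLp (fun x => schrKerDeriv s (x - p)) 2 volume := by
  refine (memLp_exp_abs hs p).of_le ?_ (ae_of_all _ fun x => ?_)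
  · have h1 : Measurable fun x => csgn (x - p) := measurable_csgn.comp (measurable_id.sub_const p)
    have h2 : Continuous fun x : ℝ => Complex.exp (Complex.I * s * (|x - p| : ℝ)) := by fun_prop
    exact ((h1.mul h2.measurable).div_const 2).aestronglyMeasurable
  · rw [schrKerDeriv, norm_div, norm_mul]
    have := norm_csgn_le (x - p)
    have h0 := norm_nonneg (Complex.exp (Complex.I * s * (|x - p| : ℝ)))
    simp only [Complex.norm_ofNat]
    nlinarith

/-- The kernel `x ↦ ĝ(x - p)` as an element of `L²`. -/
def schrKerLp {s : ℂ} (hs : 0 < s.im) (p : ℝ) : L2 := (memLp_schrKer hs p).toLp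

/-- The kernel `x ↦ ĝ'(x - p)` as an element of `L²`. -/
def schrKerDerivLp {s : ℂ} (hs : 0 < s.im) (p : ℝ) : L2 := (memLp_schrKerDeriv hs p).toLp

theorem coeFn_schrKerLp {s : ℂ} (hs : 0 < s.im) (p : ℝ) :
    schrKerLp hs p =ᵐ[volume] fun x => schrKer s (x - p) := (memLp_schrKer hs p).coeFn_toLp

theorem coeFn_schrKerDerivLp {s : ℂ} (hs : 0 < s.im) (p : ℝ) :
    schrKerDerivLp hs p =ᵐ[volume] fun x => schrKerDeriv s (x - p) :=
  (memLp_schrKerDeriv hs p).coeFn_toLp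

theorem ne_zero_of_im_pos {s : ℂ} (hs : 0 < s.im) : s ≠ 0 := by
  rintro rfl; simp at hs

theorem hasDerivAt_exp_abs (s : ℂ) (p : ℝ) {x : ℝ} (hx : x ≠ p) :
    HasDerivAt (fun x : ℝ => Complex.exp (Complex.I * s * (|x - p| : ℝ)))
      (Complex.I * s * (csgn (x - p) * Complex.exp (Complex.I * s * (|x - p| : ℝ)))) x := by
  have habs : HasDerivAt (fun x : ℝ => |x - p|) (Real.sign (x - p)) x := by
    rcases lt_or_gt_of_ne hx with h | h
    · rw [Real.sign_of_neg (sub_neg.mpr h)]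
      simpa [Function.comp_def] using
        (hasDerivAt_abs_neg (sub_neg.mpr h)).comp x ((hasDerivAt_id x).sub_const p)
    · rw [Real.sign_of_pos (sub_pos.mpr h)]
      simpa [Function.comp_def] using
        (hasDerivAt_abs_pos (sub_pos.mpr h)).comp x ((hasDerivAt_id x).sub_const p)
  have := ((habs.ofReal_comp).const_mul (Complex.I * s)).cexp
  convert this using 1
  simp only [csgn]; ring

theorem hasDerivAt_schrKer {s : ℂ} (hs : s ≠ 0) {p x : ℝ} (hx : x ≠ p) :
    HasDerivAt (fun x => schrKer s (x - p)) (schrKerDeriv s (x - p)) x := by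
  have := (hasDerivAt_exp_abs s p hx).div_const (2 * Complex.I * s)
  refine this.congr_deriv ?_
  simp only [schrKerDeriv]
  field_simp [Complex.I_ne_zero]

theorem hasDerivAt_schrKerDeriv {s : ℂ} (hs : s ≠ 0) {p x : ℝ} (hx : x ≠ p) :
    HasDerivAt (fun x => schrKerDeriv s (x - p)) (-s ^ 2 * schrKer s (x - p)) x := by
  have h0 : x - p ≠ 0 := sub_ne_zero.mpr hx
  have hc : (fun t : ℝ => schrKerDeriv s (t - p)) =ᶠ[𝓝 x] fun t =>
      csgn (x - p) * Complex.exp (Complex.I * s * (|t - p| : ℝ)) / 2 := by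
    rcases lt_or_gt_of_ne hx with h | h
    · filter_upwards [Iio_mem_nhds h] with t ht
      rw [schrKerDeriv, csgn_of_neg (sub_neg.mpr h), csgn_of_neg (sub_neg.mpr ht)]
    · filter_upwards [Ioi_mem_nhds h] with t ht
      rw [schrKerDeriv, csgn_of_pos (sub_pos.mpr h), csgn_of_pos (sub_pos.mpr ht)]
  have hsq : csgn (x - p) * csgn (x - p) = 1 := by
    rcases lt_or_gt_of_ne hx with h | h
    · rw [csgn_of_neg (sub_neg.mpr h)]; ring
    · rw [csgn_of_pos (sub_pos.mpr h)]; ring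
  refine HasDerivAt.congr_of_eventuallyEq ?_ hc
  have := ((hasDerivAt_exp_abs s p hx).const_mul (csgn (x - p))).div_const 2
  refine this.congr_deriv ?_
  simp only [schrKer]
  rw [show csgn (x - p) * (Complex.I * s * (csgn (x - p) *
    Complex.exp (Complex.I * s * (|x - p| : ℝ)))) = (csgn (x - p) * csgn (x - p)) *
    (Complex.I * s * Complex.exp (Complex.I * s * (|x - p| : ℝ))) by ring, hsq]
  field_simp [Complex.I_ne_zero]
  rw [Complex.I_sq]

theorem hasValue_schrKerLp {s : ℂ} (hs : 0 < s.im) (p y : ℝ) :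
    HasValue (schrKerLp hs p) y (schrKer s (y - p)) := by
  have hc : Continuous fun x : ℝ => schrKer s (x - p) := by unfold schrKer; fun_prop
  have := tendsto_of_ae_eq (J := Set.univ) (s := Set.univ) (y := y) hc
    ((coeFn_schrKerLp hs p).mono fun x hx _ => hx) univ_mem
  rwa [nhdsWithin_univ] at this

/-- The kernel `ĝ` is continuous, so its only singular point is removable. -/
theorem hasWeakDeriv_schrKerLp {s : ℂ} (hs : 0 < s.im) (p : ℝ) :
    HasWeakDeriv ∅ (schrKerLp hs p) (schrKerDerivLp hs p) :=
  HasWeakDeriv.of_insert (y := p) (hasWeakDeriv_of_hasDerivAt (coeFn_schrKerLp hs p)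
    (coeFn_schrKerDerivLp hs p) fun _ hx => hasDerivAt_schrKer (ne_zero_of_im_pos hs)
      (by simpa using hx)) (hasValue_schrKerLp hs p p)

theorem hasWeakDeriv_schrKerDerivLp {s : ℂ} (hs : 0 < s.im) (p : ℝ) :
    HasWeakDeriv {p} (schrKerDerivLp hs p) ((-s ^ 2) • schrKerLp hs p) := by
  refine hasWeakDeriv_of_hasDerivAt (coeFn_schrKerDerivLp hs p)
    (G := fun x => -s ^ 2 * schrKer s (x - p)) ?_ fun _ hx =>
      hasDerivAt_schrKerDeriv (ne_zero_of_im_pos hs) (by simpa using hx)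
  filter_upwards [Lp.coeFn_smul (-s ^ 2) (schrKerLp hs p), coeFn_schrKerLp hs p] with x h1 h2
  rw [h1, Pi.smul_apply, h2, smul_eq_mul]

theorem hasLeftValue_schrKerDerivLp {s : ℂ} (hs : 0 < s.im) (p : ℝ) :
    HasLeftValue (schrKerDerivLp hs p) p (-(1 / 2)) := by
  have hc : Continuous fun x : ℝ => -(Complex.exp (Complex.I * s * (|x - p| : ℝ)) / 2) := by
    fun_prop
  have := tendsto_of_ae_eq (f := schrKerDerivLp hs p) (J := Set.Iio p) (s := Set.Iio p) (y := p) hc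
    (by filter_upwards [coeFn_schrKerDerivLp hs p] with x hx hxp
        rw [hx, schrKerDeriv, csgn_of_neg (sub_neg.mpr hxp)]; ring) self_mem_nhdsWithin
  simpa [HasLeftValue] using this

theorem hasRightValue_schrKerDerivLp {s : ℂ} (hs : 0 < s.im) (p : ℝ) :
    HasRightValue (schrKerDerivLp hs p) p (1 / 2) := by
  have hc : Continuous fun x : ℝ => Complex.exp (Complex.I * s * (|x - p| : ℝ)) / 2 := by
    fun_prop
  have := tendsto_of_ae_eq (f := schrKerDerivLp hs p) (J := Set.Ioi p) (s := Set.Ioi p) (y := p) hc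
    (by filter_upwards [coeFn_schrKerDerivLp hs p] with x hx hxp
        rw [hx, schrKerDeriv, csgn_of_pos (sub_pos.mpr hxp)]; ring) self_mem_nhdsWithin
  simpa [HasRightValue] using this

open Classical in
theorem hasJump_schrKerDerivLp {s : ℂ} (hs : 0 < s.im) (p y : ℝ) :
    HasJump (schrKerDerivLp hs p) y (if y = p then 1 else 0) := by
  split_ifs with h
  · subst h
    exact ⟨_, _, hasLeftValue_schrKerDerivLp hs y, hasRightValue_schrKerDerivLp hs y, by norm_num⟩
  · obtain ⟨a, ha⟩ := exists_hasValue (hasWeakDeriv_schrKerDerivLp hs p).mem_H1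
      (by simpa using h)
    exact ha.hasJump

/-! ### Green's formula -/

theorem HasWeakDeriv.sub {S : Finset ℝ} {f f' g g' : L2} (hf : HasWeakDeriv S f f')
    (hg : HasWeakDeriv S g g') : HasWeakDeriv S (f - g) (f' - g') := by
  have := hf.add (hg.smul (-1))
  simpa only [neg_smul, one_smul, ← sub_eq_add_neg] using this

theorem HasJump.sub {f g : L2} {y : ℝ} {a b : ℂ} (hf : HasJump f y a) (hg : HasJump g y b) :
    HasJump (f - g) y (a - b) := by
  have := hf.add (hg.smul (-1))
  simpa only [neg_smul, one_smul, neg_mul, one_mul, ← sub_eq_add_neg] using this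

theorem L2_inner_eq (f g : L2) : inner ℂ f g = ∫ x, starRingEnd ℂ (f x) * g x := by
  rw [L2.inner_def]; simp only [RCLike.inner_apply']

theorem integrable_conj_mul (f g : L2) : Integrable fun x => starRingEnd ℂ (f x) * g x := by
  have := L2.integrable_inner (𝕜 := ℂ) f g
  simpa only [RCLike.inner_apply'] using this

/-- Green's formula for functions with a single singular point. -/
theorem inner_weakDeriv_add_of_singleton {y : ℝ} {f f' h h' : L2} (hf : HasWeakDeriv {y} f f')
    (hh : HasWeakDeriv {y} h h') {lf rf lh rh : ℂ} (hlf : HasLeftValue f y lf)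
    (hrf : HasRightValue f y rf) (hlh : HasLeftValue h y lh) (hrh : HasRightValue h y rh) :
    inner ℂ f' h + inner ℂ f h' = starRingEnd ℂ lf * lh - starRingEnd ℂ rf * rh := by
  have hR : ∫ x in Set.Ioi y, (starRingEnd ℂ (f' x) * h x + starRingEnd ℂ (f x) * h' x) =
      -(starRingEnd ℂ rf * rh) := by
    obtain ⟨F, hF, hfF⟩ := hf.exists_isPrimitive (J := Set.Ioi y) isOpen_Ioi (by simp)
    obtain ⟨H, hH, hhH⟩ := hh.exists_isPrimitive (J := Set.Ioi y) isOpen_Ioi (by simp)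
    rw [hrf.unique (tendsto_of_ae_eq hF.continuous hfF self_mem_nhdsWithin),
      hrh.unique (tendsto_of_ae_eq hH.continuous hhH self_mem_nhdsWithin),
      ← (hF.conj.mul hH).integral_Ioi y]
    · apply setIntegral_congr_ae measurableSet_Ioi
      filter_upwards [hfF, hhH] with x h1 h2 hx
      rw [h1 hx, h2 hx]
    · refine (integrable_conj_mul f h).integrableOn.congr ?_
      rw [EventuallyEq, ae_restrict_iff' measurableSet_Ioi]
      filter_upwards [hfF, hhH] with x h1 h2 hx
      rw [h1 hx, h2 hx]
    · refine ((integrable_conj_mul f' h).add (integrable_conj_mul f h')).integrableOn.congr ?_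
      rw [EventuallyEq, ae_restrict_iff' measurableSet_Ioi]
      filter_upwards [hfF, hhH] with x h1 h2 hx
      rw [Pi.add_apply, h1 hx, h2 hx]
  have hL : ∫ x in Set.Iio y, (starRingEnd ℂ (f' x) * h x + starRingEnd ℂ (f x) * h' x) =
      starRingEnd ℂ lf * lh := by
    obtain ⟨F, hF, hfF⟩ := hf.exists_isPrimitive (J := Set.Iio y) isOpen_Iio (by simp)
    obtain ⟨H, hH, hhH⟩ := hh.exists_isPrimitive (J := Set.Iio y) isOpen_Iio (by simp)
    rw [hlf.unique (tendsto_of_ae_eq hF.continuous hfF self_mem_nhdsWithin),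
      hlh.unique (tendsto_of_ae_eq hH.continuous hhH self_mem_nhdsWithin),
      ← (hF.conj.mul hH).integral_Iio y]
    · apply setIntegral_congr_ae measurableSet_Iio
      filter_upwards [hfF, hhH] with x h1 h2 hx
      rw [h1 hx, h2 hx]
    · refine (integrable_conj_mul f h).integrableOn.congr ?_
      rw [EventuallyEq, ae_restrict_iff' measurableSet_Iio]
      filter_upwards [hfF, hhH] with x h1 h2 hx
      rw [h1 hx, h2 hx]
    · refine ((integrable_conj_mul f' h).add (integrable_conj_mul f h')).integrableOn.congr ?_
      rw [EventuallyEq, ae_restrict_iff' measurableSet_Iio]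
      filter_upwards [hfF, hhH] with x h1 h2 hx
      rw [Pi.add_apply, h1 hx, h2 hx]
  have hi := (integrable_conj_mul f' h).add (integrable_conj_mul f h')
  have hs := intervalIntegral.integral_Iic_add_Ioi (b := y) hi.integrableOn hi.integrableOn
  rw [integral_Iic_eq_integral_Iio] at hs
  rw [L2_inner_eq, L2_inner_eq, ← integral_add (integrable_conj_mul f' h)
    (integrable_conj_mul f h')]
  refine hs.symm.trans ?_
  simp only [Pi.add_apply]
  rw [hL, hR]; ring

/-- Green's formula for `f ∈ H¹(ℝ)` and `h ∈ H¹(ℝ \ S)`: the jumps of `h` are removed one at a time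
by subtracting multiples of the kernel `ĝ'(· - y)`, which has a unit jump. -/
theorem inner_weakDeriv_add {S : Finset ℝ} {f f' h h' : L2} (hf : HasWeakDeriv ∅ f f')
    (hh : HasWeakDeriv S h h') {a c : ℝ → ℂ} (ha : ∀ y ∈ S, HasValue f y (a y))
    (hc : ∀ y ∈ S, HasJump h y (c y)) :
    inner ℂ f' h + inner ℂ f h' = -∑ y ∈ S, starRingEnd ℂ (a y) * c y := by
  induction S using Finset.induction_on generalizing h h' with
  | empty =>
    obtain ⟨p, hp⟩ := exists_hasValue hf.mem_H1 (y := 0) (by simp)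
    obtain ⟨q, hq⟩ := exists_hasValue hh.mem_H1 (y := 0) (by simp)
    rw [inner_weakDeriv_add_of_singleton (hf.mono (Finset.empty_subset {0}))
      (hh.mono (Finset.empty_subset {0})) hp.left hp.right hq.left hq.right]
    simp
  | insert y S hyS ih =>
    -- Any parameter in the upper half-plane gives a kernel with a unit jump; take `s = i`.
    have hI : 0 < Complex.I.im := by simp
    have hk := hasWeakDeriv_schrKerDerivLp hI y
    have hkS : HasWeakDeriv (insert y S) (c y • schrKerDerivLp hI y) _ :=
      (hk.mono (by simp)).smul (c y)
    have hj : ∀ x ∈ insert y S, HasJump (h - c y • schrKerDerivLp hI y) x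
        (c x - c y * (if x = y then 1 else 0)) := fun x hx => by
      classical
      exact (hc x hx).sub (by convert (hasJump_schrKerDerivLp hI y x).smul (c y))
    have hj0 := hj y (Finset.mem_insert_self y S)
    rw [if_pos rfl, mul_one, sub_self] at hj0
    obtain ⟨b, hb⟩ := hj0.exists_hasValue
    have key := ih ((hh.sub hkS).of_insert hb) (fun x hx => ha x (Finset.mem_insert_of_mem hx))
      fun x hx => by
        have := hj x (Finset.mem_insert_of_mem hx)
        rwa [if_neg (ne_of_mem_of_not_mem hx hyS), mul_zero, sub_zero] at this
    have hay := ha y (Finset.mem_insert_self y S)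
    -- The contribution of the subtracted kernel.
    have k1 := inner_weakDeriv_add_of_singleton (hf.mono (Finset.empty_subset {y})) hk hay.left
      hay.right (hasLeftValue_schrKerDerivLp hI y) (hasRightValue_schrKerDerivLp hI y)
    rw [inner_sub_right, inner_sub_right, inner_smul_right,
      inner_smul_right (𝕜 := ℂ) f _ (c y)] at key
    rw [Finset.sum_insert hyS]
    linear_combination key + c y * k1

/-! ### Self-adjointness criteria and the square of a self-adjoint operator -/

section Abstract

variable {E : Type*} [NormedAddCommGroup E] [InnerProductSpace ℂ E] [CompleteSpace E]

/-- A symmetric operator whose domain has trivial orthogonal complement and contains the domain of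
its adjoint is self-adjoint. -/
theorem isSelfAdjoint_of_symmetric {A : E →ₗ.[ℂ] E}
    (hd : ∀ u : E, (∀ x : A.domain, inner ℂ u (x : E) = 0) → u = 0)
    (hs : ∀ x y : A.domain, inner ℂ (A x) (y : E) = inner ℂ (x : E) (A y))
    (hm : ∀ u w : E, (∀ x : A.domain, inner ℂ w (x : E) = inner ℂ u (A x)) → u ∈ A.domain) :
    IsSelfAdjoint A := by
  have hdense : Dense (A.domain : Set E) := by
    rw [Submodule.dense_iff_topologicalClosure_eq_top, Submodule.topologicalClosure_eq_top_iff,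
      Submodule.eq_bot_iff]
    exact fun u hu => hd u fun x => (Submodule.mem_orthogonal' _ _).mp hu x x.2
  have hle : A ≤ A.adjoint := LinearPMap.IsFormalAdjoint.le_adjoint hdense hs
  rw [LinearPMap.isSelfAdjoint_def]
  refine (LinearPMap.eq_of_le_of_domain_eq hle (le_antisymm hle.1 fun u hu => ?_)).symm
  exact hm u (A.adjoint ⟨u, hu⟩) fun x =>
    LinearPMap.adjoint_isFormalAdjoint hdense ⟨u, hu⟩ x

theorem inner_map_eq_of_isSelfAdjoint {A : E →ₗ.[ℂ] E} (hA : IsSelfAdjoint A) (x y : A.domain) :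
    inner ℂ (A x) (y : E) = inner ℂ (x : E) (A y) := by
  have h := LinearPMap.adjoint_isFormalAdjoint hA.dense_domain
  rw [LinearPMap.isSelfAdjoint_def.mp hA] at h
  exact h x y

theorem exists_map_eq_of_isSelfAdjoint {A : E →ₗ.[ℂ] E} (hA : IsSelfAdjoint A) {u w : E}
    (h : ∀ x : A.domain, inner ℂ w (x : E) = inner ℂ u (A x)) :
    ∃ hu : u ∈ A.domain, A ⟨u, hu⟩ = w := by
  have h1 := LinearPMap.mem_adjoint_domain_of_exists (T := A) u ⟨w, h⟩
  have h2 := LinearPMap.adjoint_apply_eq hA.dense_domain ⟨u, h1⟩ h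
  have e : A.adjoint = A := LinearPMap.isSelfAdjoint_def.mp hA
  have hg : (u, w) ∈ A.adjoint.graph :=
    (LinearPMap.mem_graph_iff _).mpr ⟨⟨u, h1⟩, rfl, h2⟩
  rw [e] at hg
  obtain ⟨z, rfl, hz⟩ := (LinearPMap.mem_graph_iff _).mp hg
  exact ⟨z.2, hz⟩

/-- A symmetric operator `A` with `A + c` surjective for some real `c` is self-adjoint. -/
theorem isSelfAdjoint_of_symmetric_of_surjective {A : E →ₗ.[ℂ] E} (c : ℝ)
    (hs : ∀ x y : A.domain, inner ℂ (A x) (y : E) = inner ℂ (x : E) (A y))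
    (hc : ∀ f : E, ∃ x : A.domain, A x + (c : ℂ) • (x : E) = f) : IsSelfAdjoint A := by
  have hs' (x y : A.domain) : inner ℂ (A x + (c : ℂ) • (x : E)) (y : E) =
      inner ℂ (x : E) (A y + (c : ℂ) • (y : E)) := by
    rw [inner_add_left, inner_add_right, hs, inner_smul_left, inner_smul_right, Complex.conj_ofReal]
  refine isSelfAdjoint_of_symmetric (fun u hu => ?_) hs fun u w h => ?_
  · obtain ⟨x, rfl⟩ := hc u
    obtain ⟨y, hy⟩ := hc x
    have := hu y
    rw [hs', hy, inner_self_eq_zero] at this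
    obtain rfl : x = 0 := Subtype.ext this
    simp
  -- With `(A + c) x = w + c u`, the vector `u - x` is orthogonal to the range of `A + c`,
  -- hence zero.
  · obtain ⟨x, hx⟩ := hc (w + (c : ℂ) • u)
    obtain ⟨y, hy⟩ := hc (u - x)
    have h0 : inner ℂ (u - x) (u - x : E) = 0 := by
      nth_rw 2 [← hy]
      rw [inner_sub_left, ← hs', hx, inner_add_right, inner_add_left, ← h y, inner_smul_left,
        inner_smul_right, Complex.conj_ofReal, sub_self]
    rw [inner_self_eq_zero, sub_eq_zero] at h0
    rw [h0]
    exact x.2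

/-- von Neumann: if `A` is self-adjoint, then `A² + 1` is surjective. Decompose `(f, 0)` along the
closed graph of `A` and its orthogonal complement. -/
theorem exists_square_add_eq_of_isSelfAdjoint {A : E →ₗ.[ℂ] E} (hA : IsSelfAdjoint A) (f : E) :
    ∃ (x : E) (hx : x ∈ A.domain) (hx' : A ⟨x, hx⟩ ∈ A.domain), A ⟨A ⟨x, hx⟩, hx'⟩ + x = f := by
  let G : Submodule ℂ (WithLp 2 (E × E)) :=
    A.graph.comap (WithLp.linearEquiv 2 ℂ (E × E)).toLinearMap
  have hG : IsClosed (G : Set (WithLp 2 (E × E))) := by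
    have hc : IsClosed (A.graph : Set (E × E)) := hA.isClosed
    exact hc.preimage (WithLp.prod_continuous_ofLp 2 E E)
  have : CompleteSpace G := hG.completeSpace_coe
  obtain ⟨g, hg, k, hk, hgk⟩ := G.exists_add_mem_mem_orthogonal (WithLp.toLp 2 (f, (0 : E)))
  have hg' : (g.fst, g.snd) ∈ A.graph := hg
  obtain ⟨x, hx1, hx2⟩ := (LinearPMap.mem_graph_iff _).mp hg'
  dsimp only at hx1 hx2
  have e1 : f = g.fst + k.fst := by have := congrArg WithLp.fst hgk; simpa using this
  have e2 : 0 = g.snd + k.snd := by have := congrArg WithLp.snd hgk; simpa using this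
  -- Orthogonality of `(f - x, -A x)` to the graph says that `A x` is in the domain of the adjoint,
  -- with value `f - x`.
  have hort (y : A.domain) : inner ℂ (f - x) (y : E) = inner ℂ (A x) (A y) := by
    have hy : WithLp.toLp 2 ((y : E), A y) ∈ G := A.mem_graph y
    have := (Submodule.mem_orthogonal' _ _).mp hk _ hy
    rw [WithLp.prod_inner_apply] at this
    have k1 : k.fst = f - x := by rw [e1, hx1]; abel
    have k2 : k.snd = -A x := by rw [hx2]; exact (neg_eq_of_add_eq_zero_right e2.symm).symm
    change inner ℂ k.fst (y : E) + inner ℂ k.snd (A y) = 0 at this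
    rw [k1, k2, inner_neg_left, add_neg_eq_zero] at this
    exact this
  obtain ⟨h1, h2⟩ := exists_map_eq_of_isSelfAdjoint hA hort
  exact ⟨x, x.2, h1, by rw [h2]; abel⟩

end Abstract

/-- The operator `A² - 1/4`. -/
def squareSubQuarter (A : Spinor →ₗ.[ℂ] Spinor) : Spinor →ₗ.[ℂ] Spinor :=
  ((-(1 / 4) : ℂ) • (LinearMap.id : Spinor →ₗ[ℂ] Spinor)) +ᵥ square A

theorem addQuarter_squareSubQuarter (A : Spinor →ₗ.[ℂ] Spinor) :
    square A = addQuarter (squareSubQuarter A) := by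
  rw [addQuarter, squareSubQuarter, vadd_vadd, ← add_smul]
  simp

theorem mem_squareSubQuarter_domain (A : Spinor →ₗ.[ℂ] Spinor) (x : Spinor) :
    x ∈ (squareSubQuarter A).domain ↔ ∃ h : x ∈ A.domain, A ⟨x, h⟩ ∈ A.domain :=
  mem_square_domain A x

theorem squareSubQuarter_apply (A : Spinor →ₗ.[ℂ] Spinor) (x : Spinor)
    (hx : x ∈ (squareSubQuarter A).domain) (h : x ∈ A.domain) (h' : A ⟨x, h⟩ ∈ A.domain) :
    squareSubQuarter A ⟨x, hx⟩ = (-(1 / 4) : ℂ) • x + A ⟨A ⟨x, h⟩, h'⟩ := rfl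

/-- `A² - 1/4` is symmetric, and adding `5/4` to it gives the surjective `A² + 1`. -/
theorem isSelfAdjoint_squareSubQuarter {A : Spinor →ₗ.[ℂ] Spinor} (hA : IsSelfAdjoint A) :
    IsSelfAdjoint (squareSubQuarter A) := by
  have hq : ((-(1 / 4) : ℂ)) = ((-(1 / 4) : ℝ) : ℂ) := by push_cast; rfl
  refine isSelfAdjoint_of_symmetric_of_surjective (5 / 4) (fun ⟨x, hx⟩ ⟨y, hy⟩ => ?_) fun f => ?_
  · obtain ⟨h1, h2⟩ := (mem_squareSubQuarter_domain A x).mp hx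
    obtain ⟨k1, k2⟩ := (mem_squareSubQuarter_domain A y).mp hy
    rw [squareSubQuarter_apply A x hx h1 h2, squareSubQuarter_apply A y hy k1 k2, inner_add_left,
      inner_add_right, inner_smul_left, inner_smul_right, hq, Complex.conj_ofReal,
      inner_map_eq_of_isSelfAdjoint hA ⟨_, h2⟩ ⟨y, k1⟩,
      ← inner_map_eq_of_isSelfAdjoint hA ⟨x, h1⟩ ⟨_, k2⟩]
  · obtain ⟨x, hx, hx', h⟩ := exists_square_add_eq_of_isSelfAdjoint hA f
    refine ⟨⟨x, (mem_squareSubQuarter_domain A x).mpr ⟨hx, hx'⟩⟩, ?_⟩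
    rw [squareSubQuarter_apply A x _ hx hx', ← h]
    push_cast
    module

/-! ### The Dirac relation on components -/

/-- The graph of the Dirac operator with mass `m` and couplings `γ`, written on components: `a` is
the component in `H¹(ℝ)`, `b` the component in `H¹(ℝ \ Y)` that jumps by `-i γ_k a(y_k)` at `y_k`,
and `(c, d) = (-i b' + m a, -i a' - m b)` is the image. For `D_α` one has `(a, b) = (ψ₁, ψ₂)` and
`m = 1/2`; for `D_β` one has `(a, b) = (ψ₂, ψ₁)` and `m = -1/2`. -/
structure DiracRel {n : ℕ} (y γ : Fin n → ℝ) (m : ℝ) (a b c d : L2) : Prop where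
  fst_mem : a ∈ H1 ∅
  snd_mem : b ∈ H1 (pts y)
  jump : ∀ k, ∃ v, HasValue a (y k) v ∧ HasJump b (y k) (-Complex.I * γ k * v)
  fst_eq : c = (-Complex.I) • weakDeriv (pts y) b + (m : ℂ) • a
  snd_eq : d = (-Complex.I) • weakDeriv (pts y) a - (m : ℂ) • b

theorem mem_pts {n : ℕ} {y : Fin n → ℝ} {p : ℝ} : p ∈ pts y ↔ ∃ k, y k = p := by simp [pts]

theorem apply_mem_pts {n : ℕ} (y : Fin n → ℝ) (k : Fin n) : y k ∈ pts y := mem_pts.mpr ⟨k, rfl⟩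

/-- Green's formula for the Dirac expression. -/
theorem inner_dirac_sub {S : Finset ℝ} {m : ℝ} {f f' g g' a a' b b' : L2}
    (hf : HasWeakDeriv ∅ f f') (hg : HasWeakDeriv S g g') (ha : HasWeakDeriv ∅ a a')
    (hb : HasWeakDeriv S b b') {U V A C : ℝ → ℂ} (hU : ∀ p ∈ S, HasValue f p (U p))
    (hV : ∀ p ∈ S, HasJump g p (V p)) (hA : ∀ p ∈ S, HasValue a p (A p))
    (hC : ∀ p ∈ S, HasJump b p (C p)) :
    inner ℂ ((-Complex.I) • g' + (m : ℂ) • f) a + inner ℂ ((-Complex.I) • f' - (m : ℂ) • g) b -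
      (inner ℂ f ((-Complex.I) • b' + (m : ℂ) • a) + inner ℂ g ((-Complex.I) • a' - (m : ℂ) • b)) =
    -Complex.I * ∑ p ∈ S, (starRingEnd ℂ (U p) * C p + starRingEnd ℂ (V p) * A p) := by
  have h1 := inner_weakDeriv_add hf hb hU hC
  have h2 := congrArg (starRingEnd ℂ) (inner_weakDeriv_add ha hg hA hV)
  simp only [map_add, inner_conj_symm, map_neg, map_sum, map_mul, Complex.conj_conj] at h2
  have h3 : ∑ p ∈ S, A p * starRingEnd ℂ (V p) = ∑ p ∈ S, starRingEnd ℂ (V p) * A p :=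
    Finset.sum_congr rfl fun _ _ => mul_comm _ _
  rw [h3] at h2
  simp only [inner_add_left, inner_sub_left, inner_smul_left, inner_add_right, inner_sub_right,
    inner_smul_right, map_neg, Complex.conj_I, Complex.conj_ofReal, Finset.sum_add_distrib]
  linear_combination Complex.I * h1 + Complex.I * h2

namespace DiracRel

variable {n : ℕ} {y γ : Fin n → ℝ} {m : ℝ} {a b c d : L2}

theorem jump_eq (h : DiracRel y γ m a b c d) {A C : ℝ → ℂ} (hA : ∀ p, HasValue a p (A p))
    (hC : ∀ p, HasJump b p (C p)) (k : Fin n) : C (y k) = -Complex.I * γ k * A (y k) := by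
  obtain ⟨v, h1, h2⟩ := h.jump k
  rw [(hC _).unique h2, (hA _).unique h1]

theorem symmetric (h : DiracRel y γ m a b c d) {a₁ b₁ c₁ d₁ : L2}
    (h₁ : DiracRel y γ m a₁ b₁ c₁ d₁) :
    inner ℂ c a₁ + inner ℂ d b₁ = inner ℂ a c₁ + inner ℂ b d₁ := by
  choose U hU using fun p => exists_hasValue h.fst_mem (y := p) (by simp)
  choose A hA using fun p => exists_hasValue h₁.fst_mem (y := p) (by simp)
  choose V hV using fun p => exists_hasJump h.snd_mem p
  choose C hC using fun p => exists_hasJump h₁.snd_mem p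
  have key := inner_dirac_sub (m := m) (hasWeakDeriv_weakDeriv h.fst_mem)
    (hasWeakDeriv_weakDeriv h.snd_mem)
    (hasWeakDeriv_weakDeriv h₁.fst_mem) (hasWeakDeriv_weakDeriv h₁.snd_mem)
    (fun p _ => hU p) (fun p _ => hV p) (fun p _ => hA p) (fun p _ => hC p)
  rw [Finset.sum_eq_zero, mul_zero, sub_eq_zero] at key
  · rw [h.fst_eq, h.snd_eq, h₁.fst_eq, h₁.snd_eq, weakDeriv_of_mem_H1_empty h.fst_mem,
      weakDeriv_of_mem_H1_empty h₁.fst_mem]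
    exact key
  · intro p hp
    obtain ⟨k, rfl⟩ := mem_pts.mp hp
    rw [h.jump_eq hU hV, h₁.jump_eq hA hC]
    simp only [map_mul, map_neg, Complex.conj_I, Complex.conj_ofReal]
    ring

end DiracRel

/-- A real test function as an element of `L²`. -/
def testLp {φ : ℝ → ℝ} (h1 : ContDiff ℝ ∞ φ) (h2 : HasCompactSupport φ) : L2 :=
  ((Complex.continuous_ofReal.comp h1.continuous).memLp_of_hasCompactSupport
    (h2.comp_left Complex.ofReal_zero)).toLp

theorem coeFn_testLp {φ : ℝ → ℝ} (h1 : ContDiff ℝ ∞ φ) (h2 : HasCompactSupport φ) :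
    testLp h1 h2 =ᵐ[volume] fun x => (φ x : ℂ) := MemLp.coeFn_toLp _

theorem hasWeakDeriv_testLp {φ : ℝ → ℝ} (h1 : ContDiff ℝ ∞ φ) (h2 : HasCompactSupport φ) :
    HasWeakDeriv ∅ (testLp h1 h2) (testLp (contDiff_infty_iff_deriv.mp h1).2 h2.deriv) :=
  hasWeakDeriv_of_hasDerivAt (coeFn_testLp _ _) (coeFn_testLp _ _) fun x _ =>
    ((h1.differentiable (by simp) x).hasDerivAt).ofReal_comp

theorem hasValue_testLp {φ : ℝ → ℝ} (h1 : ContDiff ℝ ∞ φ) (h2 : HasCompactSupport φ) (p : ℝ) :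
    HasValue (testLp h1 h2) p (φ p) := by
  have := tendsto_of_ae_eq (J := Set.univ) (s := Set.univ) (y := p)
    (Complex.continuous_ofReal.comp h1.continuous)
    ((coeFn_testLp h1 h2).mono fun x hx _ => hx) univ_mem
  rwa [nhdsWithin_univ] at this

theorem inner_testLp {φ : ℝ → ℝ} (h1 : ContDiff ℝ ∞ φ) (h2 : HasCompactSupport φ) (f : L2) :
    inner ℂ (testLp h1 h2) f = ∫ x, φ x • f x := by
  rw [L2_inner_eq]
  apply integral_congr_ae
  filter_upwards [coeFn_testLp h1 h2] with x hx
  rw [hx, Complex.conj_ofReal, Complex.real_smul]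

theorem hasWeakDeriv_zero (S : Finset ℝ) : HasWeakDeriv S 0 0 := by
  have := (hasWeakDeriv_weakDeriv (zero_mem (H1 S))).smul 0
  simpa using this

theorem weakDeriv_zero (S : Finset ℝ) : weakDeriv S 0 = 0 := (hasWeakDeriv_zero S).weakDeriv_eq

/-- Testing an element of the adjoint relation against `(0, φ)`, against `(φ, 0)` with `φ` supported
off `Y`, and against a bump at `y_k` completed by a jump in the second component, shows that it
satisfies the conditions defining `DiracRel`. -/
theorem DiracRel.of_adjoint {n : ℕ} {y γ : Fin n → ℝ} (hy : Function.Injective y) {m : ℝ}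
    {u v p q : L2} (h : ∀ a b c d, DiracRel y γ m a b c d →
      inner ℂ p a + inner ℂ q b = inner ℂ u c + inner ℂ v d) :
    HasWeakDeriv ∅ u (Complex.I • (q + (m : ℂ) • v)) ∧
    HasWeakDeriv (pts y) v (Complex.I • (p - (m : ℂ) • u)) ∧
    ∀ k, ∃ w, HasValue u (y k) w ∧ HasJump v (y k) (-Complex.I * γ k * w) := by
  have hu : HasWeakDeriv ∅ u (Complex.I • (q + (m : ℂ) • v)) := by
    intro φ h1 h2 _
    have hw := hasWeakDeriv_testLp h1 h2
    have hk := hw.mono (Finset.empty_subset (pts y))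
    have e := h 0 (testLp h1 h2) _ _ ⟨zero_mem _, hk.mem_H1, fun k => ⟨0, tendsto_zero, by
      simpa using (hasValue_testLp h1 h2 (y k)).hasJump⟩, rfl, rfl⟩
    have e' := congrArg (starRingEnd ℂ) e
    simp only [hk.weakDeriv_eq, weakDeriv_zero, smul_zero, inner_zero_right, zero_add, add_zero,
      zero_sub, inner_neg_right, inner_smul_right, map_add, map_mul, map_neg, Complex.conj_I,
      Complex.conj_ofReal, inner_conj_symm, inner_testLp] at e'
    rw [integral_smul_smul, integral_smul_add h1.continuous h2, integral_smul_smul, e']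
    simp only [smul_eq_mul]
    linear_combination (∫ x, deriv φ x • u x) * Complex.I_mul_I
  have hv : HasWeakDeriv (pts y) v (Complex.I • (p - (m : ℂ) • u)) := by
    intro φ h1 h2 h3
    have hw := hasWeakDeriv_testLp h1 h2
    have hk := hw.mono (Finset.empty_subset (pts y))
    have e := h (testLp h1 h2) 0 _ _ ⟨hw.mem_H1, zero_mem _, fun k => ⟨0, by
      have h0 : φ (y k) = 0 := by
        by_contra hne
        exact h3 (subset_tsupport φ hne) (apply_mem_pts y k)
      simpa [h0] using hasValue_testLp h1 h2 (y k), by simpa using hasJump_zero (y k)⟩, rfl, rfl⟩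
    have e' := congrArg (starRingEnd ℂ) e
    simp only [hk.weakDeriv_eq, weakDeriv_zero, smul_zero, inner_zero_right, zero_add, add_zero,
      sub_zero, inner_smul_right, map_add, map_mul, map_neg, Complex.conj_I,
      Complex.conj_ofReal, inner_conj_symm, inner_testLp] at e'
    have hsub : p - (m : ℂ) • u = p + (-(m : ℂ)) • u := by rw [neg_smul, sub_eq_add_neg]
    rw [integral_smul_smul, hsub, integral_smul_add h1.continuous h2, integral_smul_smul, e']
    simp only [smul_eq_mul]
    linear_combination (∫ x, deriv φ x • v x) * Complex.I_mul_I
  refine ⟨hu, hv, fun k => ?_⟩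
  choose U hU using fun p => exists_hasValue hu.mem_H1 (y := p) (by simp)
  choose V hV using fun p => exists_hasJump hv.mem_H1 p
  refine ⟨_, hU (y k), ?_⟩
  -- A bump at `y k` vanishing at the other points, completed by a multiple of `ĝ'(· - y k)`, is
  -- related to its image by `DiracRel`; Green's formula then isolates the boundary term at `y k`.
  obtain ⟨ε, hε, hb⟩ := Metric.nhds_basis_closedBall.mem_iff.mp
    (((pts y).erase (y k)).finite_toSet.isClosed.isOpen_compl.mem_nhds
      (show y k ∈ (((pts y).erase (y k) : Finset ℝ) : Set ℝ)ᶜ by simp))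
  let θ : ContDiffBump (y k) := ⟨ε / 2, ε, by positivity, by linarith⟩
  have h1 : ContDiff ℝ ∞ θ := θ.contDiff
  have h2 : HasCompactSupport θ := θ.hasCompactSupport
  have hθ1 : θ (y k) = 1 := θ.one_of_mem_closedBall (Metric.mem_closedBall_self (by positivity))
  have hθ0 (p : ℝ) (hp : p ∈ pts y) (hpk : p ≠ y k) : θ p = 0 := by
    by_contra hne
    have : p ∈ Metric.closedBall (y k) ε := by
      rw [← θ.tsupport_eq]; exact subset_tsupport _ hne
    exact hb this (by simp [hp, hpk])
  have hI : 0 < Complex.I.im := by simp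
  have hw := hasWeakDeriv_testLp h1 h2
  have hk := (hasWeakDeriv_schrKerDerivLp hI (y k)).mono (T := pts y)
    (by simpa using apply_mem_pts y k)
  have hk' := hk.smul (-Complex.I * γ k)
  have hj (j : Fin n) : HasJump ((-Complex.I * γ k) • schrKerDerivLp hI (y k)) (y j)
      (-Complex.I * γ j * θ (y j)) := by
    have := (hasJump_schrKerDerivLp hI (y k) (y j)).smul (-Complex.I * γ k)
    by_cases hjk : j = k
    · subst hjk
      simpa [hθ1] using this
    · rw [hθ0 _ (apply_mem_pts y j) (hy.ne hjk)]
      simpa [hy.ne hjk] using this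
  have hrel : DiracRel y γ m (testLp h1 h2) ((-Complex.I * γ k) • schrKerDerivLp hI (y k)) _ _ :=
    ⟨hw.mem_H1, hk'.mem_H1, fun j => ⟨_, hasValue_testLp h1 h2 (y j), hj j⟩, rfl, rfl⟩
  have e := h _ _ _ _ hrel
  choose C hC using fun p => exists_hasJump hk'.mem_H1 p
  have key := inner_dirac_sub (m := m) hu hv hw hk' (fun p _ => hU p) (fun p _ => hV p)
    (fun p _ => hasValue_testLp h1 h2 p) (fun p _ => hC p)
  have ep : (-Complex.I) • Complex.I • (p - (m : ℂ) • u) + (m : ℂ) • u = p := by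
    rw [smul_smul, neg_mul, Complex.I_mul_I, neg_neg, one_smul, sub_add_cancel]
  have eq : (-Complex.I) • Complex.I • (q + (m : ℂ) • v) - (m : ℂ) • v = q := by
    rw [smul_smul, neg_mul, Complex.I_mul_I, neg_neg, one_smul, add_sub_cancel_right]
  rw [ep, eq, e, hk'.weakDeriv_eq, (hw.mono (Finset.empty_subset (pts y))).weakDeriv_eq, sub_self,
    Finset.sum_eq_single_of_mem (y k) (apply_mem_pts y k)] at key
  · rw [(hC (y k)).unique (hj k), hθ1] at key
    have key' := congrArg (starRingEnd ℂ) ((mul_eq_zero.mp key.symm).resolve_left (by simp))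
    simp only [map_add, map_mul, map_neg, Complex.conj_I, Complex.conj_ofReal, Complex.conj_conj,
      map_zero, Complex.ofReal_one, map_one] at key'
    have : V (y k) = -Complex.I * γ k * U (y k) := by linear_combination key'
    rw [← this]
    exact hV (y k)
  · intro x hx hxk
    obtain ⟨j, rfl⟩ := mem_pts.mp hx
    rw [(hC (y j)).unique (hj j), hθ0 _ hx hxk]
    simp

/-! ### The square of the Dirac relation -/

/-- The domain of the square of `DiracRel`, on components. -/
def SchrDom {n : ℕ} (y γ : Fin n → ℝ) (m : ℝ) (a b : L2) : Prop :=
  MemH2 (pts y) a ∧ MemH2 (pts y) b ∧ ∀ k, HasJump a (y k) 0 ∧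
    HasJump (weakDeriv (pts y) b) (y k) 0 ∧
    ∃ v w, HasValue a (y k) v ∧ HasValue (weakDeriv (pts y) b) (y k) w ∧
      HasJump (weakDeriv (pts y) a) (y k) (γ k * (2 * m * v - Complex.I * w)) ∧
      HasJump b (y k) (-Complex.I * γ k * v)

theorem tendsto_sub {F : Filter ℝ} {f g : L2} {a b : ℂ} (hf : Tendsto f (F ⊓ ae volume) (𝓝 a))
    (hg : Tendsto g (F ⊓ ae volume) (𝓝 b)) :
    Tendsto (f - g : L2) (F ⊓ ae volume) (𝓝 (a - b)) := by
  have := tendsto_add hf (tendsto_smul (-1) hg)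
  simpa only [neg_smul, one_smul, neg_mul, one_mul, ← sub_eq_add_neg] using this

theorem mem_H1_empty_of_forall {n : ℕ} {y : Fin n → ℝ} {f : L2} (hf : f ∈ H1 (pts y))
    (h0 : ∀ k, HasJump f (y k) 0) : f ∈ H1 ∅ :=
  mem_H1_empty_of_hasJump hf fun p hp => by obtain ⟨k, rfl⟩ := mem_pts.mp hp; exact h0 k

/-- If `(a, b) ↦ (c, d)` under the Dirac relation, then `c = -i b' + m a` and `d = -i a' - m b` can
be solved for `b'` and `a'`; the conditions on `(c, d)` then become conditions on `(a, b)`. -/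
theorem diracRel_diracRel_iff {n : ℕ} {y γ : Fin n → ℝ} {m : ℝ} {a b e f : L2} :
    (∃ c d, DiracRel y γ m a b c d ∧ DiracRel y γ m c d e f) ↔
      SchrDom y γ m a b ∧ e = -weakDeriv (pts y) (weakDeriv (pts y) a) + (m ^ 2 : ℂ) • a ∧
        f = -weakDeriv (pts y) (weakDeriv (pts y) b) + (m ^ 2 : ℂ) • b := by
  constructor
  · rintro ⟨c, d, h, h'⟩
    have hb' : weakDeriv (pts y) b = Complex.I • (c - (m : ℂ) • a) := by
      rw [h.fst_eq, add_sub_cancel_right, smul_smul]; simp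
    have ha' : weakDeriv (pts y) a = Complex.I • (d + (m : ℂ) • b) := by
      rw [h.snd_eq, sub_add_cancel, smul_smul]; simp
    have haY := H1_empty_le (pts y) h.fst_mem
    have hcY := H1_empty_le (pts y) h'.fst_mem
    have wb := ((hasWeakDeriv_weakDeriv hcY).sub ((hasWeakDeriv_weakDeriv haY).smul m)).smul
      Complex.I
    have wa := ((hasWeakDeriv_weakDeriv h'.snd_mem).add
      ((hasWeakDeriv_weakDeriv h.snd_mem).smul m)).smul Complex.I
    rw [← hb'] at wb
    rw [← ha'] at wa
    refine ⟨⟨⟨haY, wa.mem_H1⟩, ⟨h.snd_mem, wb.mem_H1⟩, fun k => ?_⟩, ?_, ?_⟩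
    · obtain ⟨v, h1, h2⟩ := h.jump k
      obtain ⟨w, k1, k2⟩ := h'.jump k
      have hval : HasValue (weakDeriv (pts y) b) (y k) (Complex.I * (w - m * v)) := by
        rw [hb']
        exact tendsto_smul _ (tendsto_sub k1 (tendsto_smul _ h1))
      refine ⟨h1.hasJump, hval.hasJump, v, _, h1, hval, ?_, h2⟩
      have := (k2.add (h2.smul (m : ℂ))).smul Complex.I
      rw [← ha'] at this
      convert this using 1
      linear_combination (2 * γ k * m * v) * Complex.I_mul_I
    · rw [h'.fst_eq, wa.weakDeriv_eq, h.fst_eq]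
      module
    · rw [h'.snd_eq, wb.weakDeriv_eq, h.snd_eq]
      module
  · rintro ⟨⟨⟨ha1, ha2⟩, ⟨hb1, hb2⟩, hj⟩, rfl, rfl⟩
    have ha0 : a ∈ H1 ∅ := mem_H1_empty_of_forall ha1 fun k => (hj k).1
    have hb0 : weakDeriv (pts y) b ∈ H1 ∅ := mem_H1_empty_of_forall hb2 fun k => (hj k).2.1
    have wa := hasWeakDeriv_weakDeriv ha1
    have wb := hasWeakDeriv_weakDeriv hb1
    have wc := ((hasWeakDeriv_weakDeriv hb2).smul (-Complex.I)).add (wa.smul m)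
    have wd := ((hasWeakDeriv_weakDeriv ha2).smul (-Complex.I)).sub (wb.smul m)
    refine ⟨_, _, ⟨ha0, hb1, fun k => ?_, rfl, rfl⟩, ⟨?_, wd.mem_H1, fun k => ?_, ?_, ?_⟩⟩
    · obtain ⟨-, -, v, w, h1, -, -, h2⟩ := hj k
      exact ⟨v, h1, h2⟩
    · exact (H1 ∅).add_mem ((H1 ∅).smul_mem _ hb0) ((H1 ∅).smul_mem _ ha0)
    · obtain ⟨-, -, v, w, h1, h2, h3, h4⟩ := hj k
      refine ⟨_, tendsto_add (tendsto_smul (-Complex.I) h2) (tendsto_smul (m : ℂ) h1), ?_⟩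
      convert (h3.smul (-Complex.I)).sub (h4.smul (m : ℂ)) using 1
      ring
    · rw [wd.weakDeriv_eq, smul_sub, smul_smul]
      simp only [neg_mul_neg, Complex.I_mul_I]
      module
    · rw [wc.weakDeriv_eq, smul_add, smul_smul]
      simp only [neg_mul_neg, Complex.I_mul_I]
      module

/-! ### Superpositions of kernels and the extensions on components -/

section Superposition

variable {n : ℕ} {s : ℂ} (hs : 0 < s.im) (y : Fin n → ℝ) (X : Fin n → ℂ)

/-- The superposition `∑ₖ Xₖ ĝ(· - yₖ)`. -/
def kerSum : L2 := ∑ k, X k • schrKerLp hs (y k)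

/-- The superposition `∑ₖ Xₖ ĝ'(· - yₖ)`. -/
def kerDerivSum : L2 := ∑ k, X k • schrKerDerivLp hs (y k)

theorem HasWeakDeriv.sum {ι : Type*} {S : Finset ℝ} (t : Finset ι) {f g : ι → L2}
    (h : ∀ i ∈ t, HasWeakDeriv S (f i) (g i)) :
    HasWeakDeriv S (∑ i ∈ t, f i) (∑ i ∈ t, g i) := by
  classical
  induction t using Finset.induction_on with
  | empty => simpa using hasWeakDeriv_zero S
  | insert i t hi ih =>
    rw [Finset.sum_insert hi, Finset.sum_insert hi]
    exact (h i (Finset.mem_insert_self i t)).add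
      (ih fun j hj => h j (Finset.mem_insert_of_mem hj))

theorem HasJump.sum {ι : Type*} {p : ℝ} (t : Finset ι) {f : ι → L2} {c : ι → ℂ}
    (h : ∀ i ∈ t, HasJump (f i) p (c i)) : HasJump (∑ i ∈ t, f i) p (∑ i ∈ t, c i) := by
  classical
  induction t using Finset.induction_on with
  | empty => simpa using hasJump_zero p
  | insert i t hi ih =>
    rw [Finset.sum_insert hi, Finset.sum_insert hi]
    exact (h i (Finset.mem_insert_self i t)).add
      (ih fun j hj => h j (Finset.mem_insert_of_mem hj))

theorem hasWeakDeriv_kerSum : HasWeakDeriv ∅ (kerSum hs y X) (kerDerivSum hs y X) :=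
  HasWeakDeriv.sum _ fun k _ => (hasWeakDeriv_schrKerLp hs (y k)).smul (X k)

theorem hasWeakDeriv_kerDerivSum :
    HasWeakDeriv (pts y) (kerDerivSum hs y X) ((-s ^ 2) • kerSum hs y X) := by
  rw [kerSum, Finset.smul_sum]
  refine HasWeakDeriv.sum _ fun k _ => ?_
  rw [smul_comm]
  exact ((hasWeakDeriv_schrKerDerivLp hs (y k)).mono
    (by simpa using apply_mem_pts y k)).smul (X k)

theorem hasJump_kerDerivSum {y : Fin n → ℝ} (hy : Function.Injective y) (k : Fin n) :
    HasJump (kerDerivSum hs y X) (y k) (X k) := by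
  classical
  have := HasJump.sum Finset.univ fun j _ =>
    (hasJump_schrKerDerivLp hs (y j) (y k)).smul (X j)
  have e : ∑ j, X j * (if y k = y j then 1 else 0) = X k := by simp [hy.eq_iff]
  rw [e] at this
  exact this

theorem coeFn_sum_smul {ι : Type*} (t : Finset ι) (c : ι → ℂ) (f : ι → L2) :
    (∑ i ∈ t, c i • f i : L2) =ᵐ[volume] fun x => ∑ i ∈ t, f i x * c i := by
  classical
  induction t using Finset.induction_on with
  | empty =>
    filter_upwards [Lp.coeFn_zero ℂ 2 (volume : Measure ℝ)] with x hx
    simp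
  | insert i t hi ih =>
    rw [Finset.sum_insert hi]
    filter_upwards [Lp.coeFn_add (c i • f i) (∑ j ∈ t, c j • f j), Lp.coeFn_smul (c i) (f i), ih]
      with x h1 h2 h3
    rw [h1, Pi.add_apply, h2, h3, Finset.sum_insert hi, Pi.smul_apply, smul_eq_mul, mul_comm]

theorem coeFn_kerSum :
    kerSum hs y X =ᵐ[volume] fun x => ∑ k, schrKer s (x - y k) * X k := by
  have h : ∀ᵐ x, ∀ k, schrKerLp hs (y k) x = schrKer s (x - y k) :=
    ae_all_iff.mpr fun k => coeFn_schrKerLp hs (y k)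
  filter_upwards [coeFn_sum_smul Finset.univ X fun k => schrKerLp hs (y k), h] with x h1 h2
  rw [kerSum, h1]; simp only [h2]

theorem coeFn_kerDerivSum :
    kerDerivSum hs y X =ᵐ[volume] fun x => ∑ k, schrKerDeriv s (x - y k) * X k := by
  have h : ∀ᵐ x, ∀ k, schrKerDerivLp hs (y k) x = schrKerDeriv s (x - y k) :=
    ae_all_iff.mpr fun k => coeFn_schrKerDerivLp hs (y k)
  filter_upwards [coeFn_sum_smul Finset.univ X fun k => schrKerDerivLp hs (y k), h] with x h1 h2
  rw [kerDerivSum, h1]; simp only [h2]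

end Superposition

theorem HasMean.eq_of_hasValue {f : L2} {p : ℝ} {a b : ℂ} (h : HasMean f p a)
    (h' : HasValue f p b) : a = b := h.unique h'.hasMean

/-- The Dirac relation in terms of the resolvent kernels: `a = a_z + (m + z) ∑ X_k ĝ(· - y_k)` and
`b = b_z - i ∑ X_k ĝ'(· - y_k)` with `a_z, b_z ∈ H¹(ℝ)` and `⟨a⟩_{y_k} = γ_k⁻¹ X_k`. -/
theorem diracRel_iff_exists {n : ℕ} {y γ : Fin n → ℝ} (hy : Function.Injective y)
    (hγ : ∀ k, γ k ≠ 0) {m : ℝ} {z s : ℂ} (hsz : s ^ 2 = z ^ 2 - (m : ℂ) ^ 2) (hs : 0 < s.im)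
    {a b c d : L2} :
    DiracRel y γ m a b c d ↔ ∃ (az bz : L2) (X : Fin n → ℂ), az ∈ H1 ∅ ∧ bz ∈ H1 ∅ ∧
      a = az + (m + z) • kerSum hs y X ∧ b = bz + (-Complex.I) • kerDerivSum hs y X ∧
      (∀ k, HasMean a (y k) ((γ k : ℂ)⁻¹ * X k)) ∧
      -c + z • a = -((-Complex.I) • weakDeriv ∅ bz + (m : ℂ) • az) + z • az ∧
      -d + z • b = -((-Complex.I) • weakDeriv ∅ az - (m : ℂ) • bz) + z • bz := by
  have hγ' (k : Fin n) : (γ k : ℂ) ≠ 0 := Complex.ofReal_ne_zero.mpr (hγ k)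
  constructor
  · rintro ⟨ha, hb, hj, rfl, rfl⟩
    choose A hA hA' using hj
    -- With this choice `-i ∑ X_k ĝ'(· - y_k)` has the same jumps as `b`.
    set X : Fin n → ℂ := fun k => γ k * A k
    have hK := hasWeakDeriv_kerSum hs y X
    have hL := hasWeakDeriv_kerDerivSum hs y X
    have wa := hasWeakDeriv_weakDeriv ha
    have wb := hasWeakDeriv_weakDeriv hb
    have waz := wa.sub (hK.smul (m + z))
    have wbz := (wb.sub (hL.smul (-Complex.I))).of_hasJump_zero fun p hp => by
      obtain ⟨k, rfl⟩ := mem_pts.mp hp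
      convert (hA' k).sub ((hasJump_kerDerivSum hs X hy k).smul (-Complex.I)) using 1
      simp only [X]; ring
    refine ⟨_, _, X, waz.mem_H1, wbz.mem_H1, (sub_add_cancel _ _).symm,
      (sub_add_cancel _ _).symm, fun k => ?_, ?_, ?_⟩
    · convert (hA k).hasMean using 1
      simp only [X]; rw [inv_mul_cancel_left₀ (hγ' k)]
    · rw [wbz.weakDeriv_eq]
      have hI : (-Complex.I) • (-Complex.I) • (-s ^ 2) • kerSum hs y X = s ^ 2 • kerSum hs y X := by
        rw [smul_smul, smul_smul]; congr 1; linear_combination (-s ^ 2) * Complex.I_mul_I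
      rw [smul_sub, hI, hsz]
      module
    · rw [waz.weakDeriv_eq, weakDeriv_of_mem_H1_empty ha]
      module
  · rintro ⟨az, bz, X, haz, hbz, rfl, rfl, hmean, hc, hd⟩
    have hK := hasWeakDeriv_kerSum hs y X
    have hL := hasWeakDeriv_kerDerivSum hs y X
    have wa := (hasWeakDeriv_weakDeriv haz).add (hK.smul (m + z))
    have wb := ((hasWeakDeriv_weakDeriv hbz).mono (Finset.empty_subset (pts y))).add
      (hL.smul (-Complex.I))
    refine ⟨wa.mem_H1, wb.mem_H1, fun k => ?_, ?_, ?_⟩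
    · obtain ⟨v, hv⟩ := exists_hasValue wa.mem_H1 (y := y k) (by simp)
      obtain ⟨w, hw⟩ := exists_hasValue hbz (y := y k) (by simp)
      refine ⟨v, hv, ?_⟩
      rw [← (hmean k).eq_of_hasValue hv]
      convert hw.hasJump.add ((hasJump_kerDerivSum hs X hy k).smul (-Complex.I)) using 1
      rw [mul_assoc, mul_inv_cancel_left₀ (hγ' k), zero_add]
    · rw [wb.weakDeriv_eq]
      have hI : (-Complex.I) • (-Complex.I) • (-s ^ 2) • kerSum hs y X = s ^ 2 • kerSum hs y X := by
        rw [smul_smul, smul_smul]; congr 1; linear_combination (-s ^ 2) * Complex.I_mul_I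
      rw [smul_add, hI, hsz]
      linear_combination (norm := module) (-1 : ℂ) • hc
    · rw [(wa.mono (Finset.empty_subset (pts y))).weakDeriv_eq]
      linear_combination (norm := module) (-1 : ℂ) • hd

/-- The Schrödinger relation in terms of the resolvent kernels: `a = a_z + ∑ X_k ĝ(· - y_k)` and
`b = b_z - ∑ Z_k ĝ'(· - y_k)` with `a_z, b_z ∈ H²(ℝ)`, `⟨a⟩_{y_k} = -i γ_k⁻¹ Z_k` and
`⟨b'⟩_{y_k} = γ_k⁻¹ (i X_k - 2 m Z_k)`. -/
theorem schrDom_iff_exists {n : ℕ} {y γ : Fin n → ℝ} (hy : Function.Injective y)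
    (hγ : ∀ k, γ k ≠ 0) {m : ℝ} {z s : ℂ} (hsz : s ^ 2 = z) (hs : 0 < s.im) {a b e f : L2} :
    (SchrDom y γ m a b ∧ e = -weakDeriv (pts y) (weakDeriv (pts y) a) ∧
        f = -weakDeriv (pts y) (weakDeriv (pts y) b)) ↔
      ∃ (az bz : L2) (X Z : Fin n → ℂ), MemH2 ∅ az ∧ MemH2 ∅ bz ∧
      a = az + kerSum hs y X ∧ b = bz - kerDerivSum hs y Z ∧
      (∀ k, HasMean a (y k) ((γ k : ℂ)⁻¹ * (-Complex.I * Z k))) ∧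
      (∀ k, HasMean (weakDeriv (pts y) b) (y k)
        ((γ k : ℂ)⁻¹ * (Complex.I * X k - 2 * m * Z k))) ∧
      -e + z • a = -(-weakDeriv ∅ (weakDeriv ∅ az)) + z • az ∧
      -f + z • b = -(-weakDeriv ∅ (weakDeriv ∅ bz)) + z • bz := by
  have hγ' (k : Fin n) : (γ k : ℂ) ≠ 0 := Complex.ofReal_ne_zero.mpr (hγ k)
  constructor
  · rintro ⟨⟨⟨ha1, ha2⟩, ⟨hb1, hb2⟩, hj⟩, rfl, rfl⟩
    choose hja hjb A B hA hB hA' hB' using hj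
    -- `X` is the jump of `a'` and `-Z` that of `b`; the superpositions carry exactly these jumps.
    set Z : Fin n → ℂ := fun k => Complex.I * γ k * A k
    set X : Fin n → ℂ := fun k => γ k * (2 * m * A k - Complex.I * B k)
    have hK := hasWeakDeriv_kerSum hs y X
    have hL := hasWeakDeriv_kerDerivSum hs y X
    have hN := hasWeakDeriv_kerSum hs y Z
    have hM := hasWeakDeriv_kerDerivSum hs y Z
    have ha0 := (hasWeakDeriv_weakDeriv ha1).of_hasJump_zero fun p hp => by
      obtain ⟨k, rfl⟩ := mem_pts.mp hp; exact hja k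
    have hb0 := (hasWeakDeriv_weakDeriv hb2).of_hasJump_zero fun p hp => by
      obtain ⟨k, rfl⟩ := mem_pts.mp hp; exact hjb k
    have waz := ha0.sub hK
    have waz' := ((hasWeakDeriv_weakDeriv ha2).sub hL).of_hasJump_zero fun p hp => by
      obtain ⟨k, rfl⟩ := mem_pts.mp hp
      convert (hA' k).sub (hasJump_kerDerivSum hs X hy k) using 1
      simp only [X]; ring
    have wbz := ((hasWeakDeriv_weakDeriv hb1).add hM).of_hasJump_zero fun p hp => by
      obtain ⟨k, rfl⟩ := mem_pts.mp hp
      convert (hB' k).add (hasJump_kerDerivSum hs Z hy k) using 1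
      simp only [Z]; ring
    have wbz' := hb0.add (hN.smul (-s ^ 2))
    refine ⟨_, _, X, Z, ⟨waz.mem_H1, ?_⟩, ⟨wbz.mem_H1, ?_⟩, (sub_add_cancel _ _).symm,
      (add_sub_cancel_right _ _).symm, fun k => ?_, fun k => ?_, ?_, ?_⟩
    · rw [waz.weakDeriv_eq]; exact waz'.mem_H1
    · rw [wbz.weakDeriv_eq]; exact wbz'.mem_H1
    · convert (hA k).hasMean using 1
      simp only [Z]
      rw [show -Complex.I * (Complex.I * γ k * A k) = γ k * A k by
        linear_combination (-γ k * A k) * Complex.I_mul_I, inv_mul_cancel_left₀ (hγ' k)]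
    · convert (hB k).hasMean using 1
      simp only [X, Z]
      rw [show Complex.I * (γ k * (2 * m * A k - Complex.I * B k)) -
        2 * m * (Complex.I * γ k * A k) = γ k * B k by
        linear_combination (-γ k * B k) * Complex.I_mul_I, inv_mul_cancel_left₀ (hγ' k)]
    · rw [waz.weakDeriv_eq, waz'.weakDeriv_eq, ← hsz]
      module
    · rw [wbz.weakDeriv_eq, wbz'.weakDeriv_eq, ← hsz]
      module
  · rintro ⟨az, bz, X, Z, ⟨haz, haz'⟩, ⟨hbz, hbz'⟩, rfl, rfl, hma, hmb, he, hf⟩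
    have hY := Finset.empty_subset (pts y)
    have hK := hasWeakDeriv_kerSum hs y X
    have hL := hasWeakDeriv_kerDerivSum hs y X
    have hN := hasWeakDeriv_kerSum hs y Z
    have hM := hasWeakDeriv_kerDerivSum hs y Z
    have wa := (hasWeakDeriv_weakDeriv haz).add hK
    have wa' := ((hasWeakDeriv_weakDeriv haz').mono hY).add hL
    have wb := ((hasWeakDeriv_weakDeriv hbz).mono hY).sub hM
    have wb' := (hasWeakDeriv_weakDeriv hbz').sub (hN.smul (-s ^ 2))
    have ea := (wa.mono hY).weakDeriv_eq
    have eb := wb.weakDeriv_eq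
    rw [eb] at hmb
    refine ⟨⟨⟨(wa.mono hY).mem_H1, ?_⟩, ⟨wb.mem_H1, ?_⟩, fun k => ?_⟩, ?_, ?_⟩
    · rw [ea]; exact wa'.mem_H1
    · rw [eb]; exact (wb'.mono hY).mem_H1
    · obtain ⟨v, hv⟩ := exists_hasValue wa.mem_H1 (y := y k) (by simp)
      obtain ⟨w, hw⟩ := exists_hasValue wb'.mem_H1 (y := y k) (by simp)
      obtain ⟨v', hv'⟩ := exists_hasValue haz' (y := y k) (by simp)
      obtain ⟨w', hw'⟩ := exists_hasValue hbz (y := y k) (by simp)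
      have e1 := (hma k).eq_of_hasValue hv
      have e2 := (hmb k).eq_of_hasValue hw
      rw [inv_mul_eq_iff_eq_mul₀ (hγ' k)] at e1 e2
      rw [ea, eb]
      refine ⟨hv.hasJump, hw.hasJump, v, w, hv, hw, ?_, ?_⟩
      · convert hv'.hasJump.add (hasJump_kerDerivSum hs X hy k) using 1
        linear_combination (-2 * m) * e1 + Complex.I * e2 - X k * Complex.I_mul_I
      · convert hw'.hasJump.sub (hasJump_kerDerivSum hs Z hy k) using 1
        linear_combination Complex.I * e1 + Z k * Complex.I_mul_I
    · rw [ea, wa'.weakDeriv_eq, hsz]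
      linear_combination (norm := module) (-1 : ℂ) • he
    · rw [eb, (wb'.mono hY).weakDeriv_eq, hsz]
      linear_combination (norm := module) (-1 : ℂ) • hf

/-! ### The operators `D_α` and `D_β` -/

theorem spinor_inner_eq (Ψ Φ : Spinor) :
    inner ℂ Ψ Φ = inner ℂ Ψ.fst Φ.fst + inner ℂ Ψ.snd Φ.snd := WithLp.prod_inner_apply _ _

theorem spinor_ext {Ψ Φ : Spinor} (h1 : Ψ.fst = Φ.fst) (h2 : Ψ.snd = Φ.snd) : Ψ = Φ :=
  WithLp.ofLp_injective 2 (Prod.ext h1 h2)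

theorem spinor_ext_iff {Ψ Φ : Spinor} : Ψ = Φ ↔ Ψ.fst = Φ.fst ∧ Ψ.snd = Φ.snd :=
  ⟨fun h => h ▸ ⟨rfl, rfl⟩, fun h => spinor_ext h.1 h.2⟩

section Operators

variable {n : ℕ} {y γ : Fin n → ℝ}

theorem mem_graph_diracAlpha {Ψ Φ : Spinor} :
    (Ψ, Φ) ∈ (diracAlpha y γ).graph ↔ DiracRel y γ (1 / 2) Ψ.fst Ψ.snd Φ.fst Φ.snd := by
  have hm : (((1 / 2 : ℝ) : ℝ) : ℂ) = 1 / 2 := by push_cast; rfl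
  rw [LinearPMap.mem_graph_iff]
  constructor
  · rintro ⟨⟨x, h1, h2, h3⟩, hx, hΦ⟩
    dsimp only at hx hΦ
    subst hx hΦ
    exact ⟨h1, h2, h3, by rw [hm]; rfl, by rw [hm]; rfl⟩
  · rintro ⟨h1, h2, h3, h4, h5⟩
    refine ⟨⟨Ψ, h1, h2, h3⟩, rfl, spinor_ext ?_ ?_⟩
    · dsimp only; rw [h4, hm]; rfl
    · dsimp only; rw [h5, hm]; rfl

theorem mem_graph_diracBeta {Ψ Φ : Spinor} :
    (Ψ, Φ) ∈ (diracBeta y γ).graph ↔ DiracRel y γ (-(1 / 2)) Ψ.snd Ψ.fst Φ.snd Φ.fst := by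
  have hm : ((-(1 / 2 : ℝ) : ℝ) : ℂ) = -(1 / 2) := by push_cast; rfl
  rw [LinearPMap.mem_graph_iff]
  constructor
  · rintro ⟨⟨x, h1, h2, h3⟩, hx, hΦ⟩
    dsimp only at hx hΦ
    subst hx hΦ
    refine ⟨h1, h2, h3, ?_, ?_⟩
    · rw [hm, neg_smul _ x.snd, ← sub_eq_add_neg]; rfl
    · rw [hm, neg_smul _ x.fst, sub_neg_eq_add]; rfl
  · rintro ⟨h1, h2, h3, h4, h5⟩
    refine ⟨⟨Ψ, h1, h2, h3⟩, rfl, spinor_ext ?_ ?_⟩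
    · dsimp only; rw [h5, hm, neg_smul _ Ψ.fst, sub_neg_eq_add]; rfl
    · dsimp only; rw [h4, hm, neg_smul _ Ψ.snd, ← sub_eq_add_neg]; rfl

theorem exists_map_of_mem_graph {A : Spinor →ₗ.[ℂ] Spinor} {Ψ Φ : Spinor} (h : (Ψ, Φ) ∈ A.graph) :
    ∃ hΨ : Ψ ∈ A.domain, A ⟨Ψ, hΨ⟩ = Φ := by
  obtain ⟨x, rfl, hx⟩ := (LinearPMap.mem_graph_iff _).mp h
  exact ⟨x.2, hx⟩

/-- The domain of the Dirac relation is dense: if `(p, q)` is orthogonal to it, then `(0, 0)` lies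
in the domain of the adjoint relation with image `(p, q)`. -/
theorem DiracRel.eq_zero_of_orthogonal (hy : Function.Injective y) {m : ℝ} {p q : L2}
    (h : ∀ a b c d, DiracRel y γ m a b c d → inner ℂ p a + inner ℂ q b = 0) : p = 0 ∧ q = 0 := by
  obtain ⟨h1, h2, -⟩ := DiracRel.of_adjoint hy (u := 0) (v := 0) (p := p) (q := q) (γ := γ) (m := m)
    fun a b c d hr => by rw [h a b c d hr, inner_zero_left, inner_zero_left, add_zero]
  have e1 := h1.unique (hasWeakDeriv_zero _)
  have e2 := h2.unique (hasWeakDeriv_zero _)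
  rw [smul_zero, add_zero, smul_eq_zero_iff_right Complex.I_ne_zero] at e1
  rw [smul_zero, sub_zero, smul_eq_zero_iff_right Complex.I_ne_zero] at e2
  exact ⟨e2, e1⟩

theorem isSelfAdjoint_diracAlpha (hy : Function.Injective y) : IsSelfAdjoint (diracAlpha y γ) := by
  refine isSelfAdjoint_of_symmetric (fun u hu => ?_) (fun x x' => ?_) fun u w h => ?_
  · obtain ⟨h1, h2⟩ := DiracRel.eq_zero_of_orthogonal (γ := γ) (m := 1 / 2) hy
      (p := u.fst) (q := u.snd) fun a b c d hr => by
        obtain ⟨hΨ, -⟩ := exists_map_of_mem_graph (mem_graph_diracAlpha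
          (Ψ := WithLp.toLp 2 (a, b)) (Φ := WithLp.toLp 2 (c, d)).mpr hr)
        have := hu ⟨_, hΨ⟩
        rwa [spinor_inner_eq] at this
    exact spinor_ext h1 h2
  · rw [spinor_inner_eq, spinor_inner_eq]
    exact (mem_graph_diracAlpha.mp (LinearPMap.mem_graph _ x)).symmetric
      (mem_graph_diracAlpha.mp (LinearPMap.mem_graph _ x'))
  · obtain ⟨h1, h2, h3⟩ := DiracRel.of_adjoint hy (u := u.fst) (v := u.snd) (p := w.fst)
      (q := w.snd) (γ := γ) (m := 1 / 2) fun a b c d hr => by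
        obtain ⟨hΨ, e⟩ := exists_map_of_mem_graph (mem_graph_diracAlpha
          (Ψ := WithLp.toLp 2 (a, b)) (Φ := WithLp.toLp 2 (c, d)).mpr hr)
        have := h ⟨_, hΨ⟩
        rwa [e, spinor_inner_eq, spinor_inner_eq] at this
    exact ⟨h1.mem_H1, h2.mem_H1, h3⟩

theorem isSelfAdjoint_diracBeta (hy : Function.Injective y) : IsSelfAdjoint (diracBeta y γ) := by
  refine isSelfAdjoint_of_symmetric (fun u hu => ?_) (fun x x' => ?_) fun u w h => ?_
  · obtain ⟨h1, h2⟩ := DiracRel.eq_zero_of_orthogonal (γ := γ) (m := -(1 / 2)) hy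
      (p := u.snd) (q := u.fst) fun a b c d hr => by
        obtain ⟨hΨ, -⟩ := exists_map_of_mem_graph (mem_graph_diracBeta
          (Ψ := WithLp.toLp 2 (b, a)) (Φ := WithLp.toLp 2 (d, c)).mpr hr)
        have := hu ⟨_, hΨ⟩
        rwa [spinor_inner_eq, add_comm] at this
    exact spinor_ext h2 h1
  · rw [spinor_inner_eq, spinor_inner_eq]
    exact (add_comm _ _).trans (((mem_graph_diracBeta.mp (LinearPMap.mem_graph _ x)).symmetric
      (mem_graph_diracBeta.mp (LinearPMap.mem_graph _ x'))).trans (add_comm _ _))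
  · obtain ⟨h1, h2, h3⟩ := DiracRel.of_adjoint hy (u := u.snd) (v := u.fst) (p := w.snd)
      (q := w.fst) (γ := γ) (m := -(1 / 2)) fun a b c d hr => by
        obtain ⟨hΨ, e⟩ := exists_map_of_mem_graph (mem_graph_diracBeta
          (Ψ := WithLp.toLp 2 (b, a)) (Φ := WithLp.toLp 2 (d, c)).mpr hr)
        have := h ⟨_, hΨ⟩
        rw [e, spinor_inner_eq, spinor_inner_eq] at this
        exact (add_comm _ _).trans (this.trans (add_comm _ _))
    exact ⟨h1.mem_H1, h2.mem_H1, h3⟩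

theorem mem_graph_squareSubQuarter {A : Spinor →ₗ.[ℂ] Spinor} {Ψ Φ : Spinor} :
    (Ψ, Φ) ∈ (squareSubQuarter A).graph ↔
      ∃ Ξ, (Ψ, Ξ) ∈ A.graph ∧ (Ξ, Φ + (1 / 4 : ℂ) • Ψ) ∈ A.graph := by
  constructor
  · intro h
    obtain ⟨hΨ, rfl⟩ := exists_map_of_mem_graph h
    obtain ⟨h1, h2⟩ := (mem_squareSubQuarter_domain A Ψ).mp hΨ
    refine ⟨A ⟨Ψ, h1⟩, A.mem_graph ⟨Ψ, h1⟩, ?_⟩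
    convert A.mem_graph ⟨_, h2⟩ using 2
    rw [squareSubQuarter_apply A Ψ hΨ h1 h2]
    module
  · rintro ⟨Ξ, h1, h2⟩
    obtain ⟨hΨ, rfl⟩ := exists_map_of_mem_graph h1
    obtain ⟨hΞ, e⟩ := exists_map_of_mem_graph h2
    refine (LinearPMap.mem_graph_iff _).mpr
      ⟨⟨Ψ, (mem_squareSubQuarter_domain A Ψ).mpr ⟨hΨ, hΞ⟩⟩, rfl, ?_⟩
    dsimp only
    rw [squareSubQuarter_apply A Ψ _ hΨ hΞ, e]
    module

theorem domAlpha_iff {Ψ : Spinor} : DomAlpha y γ Ψ ↔ SchrDom y γ (1 / 2) Ψ.fst Ψ.snd := by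
  have h2 : (2 * ((1 / 2 : ℝ) : ℂ)) = 1 := by push_cast; ring
  simp only [DomAlpha, SchrDom, h2, one_mul]

theorem domBeta_iff {Ψ : Spinor} : DomBeta y γ Ψ ↔ SchrDom y γ (-(1 / 2)) Ψ.snd Ψ.fst := by
  have h2 (k : Fin n) (a b : ℂ) : (γ k : ℂ) * (2 * ((-(1 / 2) : ℝ) : ℂ) * a - Complex.I * b) =
      -γ k * (a + Complex.I * b) := by push_cast; ring
  simp only [DomBeta, SchrDom, h2]
  constructor
  · rintro ⟨h1, h2, h3⟩
    refine ⟨h2, h1, fun k => ?_⟩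
    obtain ⟨k1, k2, a, b, k3, k4, k5, k6⟩ := h3 k
    exact ⟨k2, k1, a, b, k3, k4, k6, k5⟩
  · rintro ⟨h1, h2, h3⟩
    refine ⟨h2, h1, fun k => ?_⟩
    obtain ⟨k1, k2, a, b, k3, k4, k5, k6⟩ := h3 k
    exact ⟨k2, k1, a, b, k3, k4, k6, k5⟩

theorem mem_graph_squareSubQuarter_diracAlpha {Ψ Φ : Spinor} :
    (Ψ, Φ) ∈ (squareSubQuarter (diracAlpha y γ)).graph ↔
      SchrDom y γ (1 / 2) Ψ.fst Ψ.snd ∧ Φ.fst = -weakDeriv (pts y) (weakDeriv (pts y) Ψ.fst) ∧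
        Φ.snd = -weakDeriv (pts y) (weakDeriv (pts y) Ψ.snd) := by
  have hq : (((1 / 2 : ℝ) : ℂ)) ^ 2 = 1 / 4 := by push_cast; ring
  have key := diracRel_diracRel_iff (y := y) (γ := γ) (m := 1 / 2) (a := Ψ.fst) (b := Ψ.snd)
    (e := Φ.fst + (1 / 4 : ℂ) • Ψ.fst) (f := Φ.snd + (1 / 4 : ℂ) • Ψ.snd)
  rw [hq, add_left_inj, add_left_inj] at key
  rw [mem_graph_squareSubQuarter, ← key]
  simp only [mem_graph_diracAlpha]
  exact ⟨fun ⟨Ξ, h1, h2⟩ => ⟨Ξ.fst, Ξ.snd, h1, h2⟩,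
    fun ⟨c, d, h1, h2⟩ => ⟨WithLp.toLp 2 (c, d), h1, h2⟩⟩

theorem mem_graph_squareSubQuarter_diracBeta {Ψ Φ : Spinor} :
    (Ψ, Φ) ∈ (squareSubQuarter (diracBeta y γ)).graph ↔
      SchrDom y γ (-(1 / 2)) Ψ.snd Ψ.fst ∧
        Φ.snd = -weakDeriv (pts y) (weakDeriv (pts y) Ψ.snd) ∧
        Φ.fst = -weakDeriv (pts y) (weakDeriv (pts y) Ψ.fst) := by
  have hq : (((-(1 / 2) : ℝ) : ℂ)) ^ 2 = 1 / 4 := by push_cast; ring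
  have key := diracRel_diracRel_iff (y := y) (γ := γ) (m := -(1 / 2)) (a := Ψ.snd) (b := Ψ.fst)
    (e := Φ.snd + (1 / 4 : ℂ) • Ψ.snd) (f := Φ.fst + (1 / 4 : ℂ) • Ψ.fst)
  rw [hq, add_left_inj, add_left_inj] at key
  rw [mem_graph_squareSubQuarter, ← key]
  simp only [mem_graph_diracBeta]
  exact ⟨fun ⟨Ξ, h1, h2⟩ => ⟨Ξ.snd, Ξ.fst, h1, h2⟩,
    fun ⟨c, d, h1, h2⟩ => ⟨WithLp.toLp 2 (d, c), h1, h2⟩⟩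

end Operators

/-! ### The extensions labelled by couples -/

section Extensions

theorem blockDiagonal_mulVec_apply {n N : ℕ} (M : Fin n → Matrix (Fin N) (Fin N) ℂ)
    (ξ : Fin N × Fin n → ℂ) (i : Fin N) (k : Fin n) :
    (Matrix.blockDiagonal M *ᵥ ξ) (i, k) = ∑ j, M k i j * ξ (j, k) := by
  simp only [Matrix.mulVec, dotProduct, Fintype.sum_prod_type, Matrix.blockDiagonal_apply]
  refine Finset.sum_congr rfl fun j _ => ?_
  rw [Finset.sum_eq_single k] <;> simp +contextual [eq_comm]

theorem eq_add_iff_ae {f g h : L2} {H : ℝ → ℂ} (hH : h =ᵐ[volume] H) :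
    f = g + h ↔ ∀ᵐ x, f x = g x + H x := by
  constructor
  · rintro rfl
    filter_upwards [Lp.coeFn_add g h, hH] with x h1 h2
    rw [h1, Pi.add_apply, h2]
  · intro hf
    apply Lp.ext
    filter_upwards [Lp.coeFn_add g h, hH, hf] with x h1 h2 h3
    rw [h1, Pi.add_apply, h2, h3]

theorem exists_hasMean {S : Finset ℝ} {f : L2} (hf : f ∈ H1 S) (p : ℝ) : ∃ c, HasMean f p c := by
  obtain ⟨l, hl⟩ := exists_hasLeftValue hf p
  obtain ⟨r, hr⟩ := exists_hasRightValue hf p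
  exact ⟨_, l, r, hl, hr, rfl⟩

variable {n : ℕ} {y γ : Fin n → ℝ}

theorem coeFn_smul_kerSum {s : ℂ} (hs : 0 < s.im) (c : ℂ) (X : Fin n → ℂ) :
    (c • kerSum hs y X : L2) =ᵐ[volume] fun x => c * ∑ k, schrKer s (x - y k) * X k := by
  filter_upwards [Lp.coeFn_smul c (kerSum hs y X), coeFn_kerSum hs y X] with x h1 h2
  rw [h1, Pi.smul_apply, h2, smul_eq_mul]

theorem coeFn_smul_kerDerivSum {s : ℂ} (hs : 0 < s.im) (c : ℂ) (X : Fin n → ℂ) :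
    (c • kerDerivSum hs y X : L2) =ᵐ[volume]
      fun x => c * ∑ k, schrKerDeriv s (x - y k) * X k := by
  filter_upwards [Lp.coeFn_smul c (kerDerivSum hs y X), coeFn_kerDerivSum hs y X] with x h1 h2
  rw [h1, Pi.smul_apply, h2, smul_eq_mul]

theorem diracG_of_snd_eq_zero {z s : ℂ} {ξ : Fin 2 × Fin n → ℂ} (h : ∀ k, ξ (1, k) = 0) (x : ℝ) :
    diracG y z s ξ 0 x = (1 / 2 + z) * ∑ k, schrKer s (x - y k) * ξ (0, k) ∧
    diracG y z s ξ 1 x = -Complex.I * ∑ k, schrKerDeriv s (x - y k) * ξ (0, k) := by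
  simp [diracG, diracKer, h, Finset.mul_sum, mul_assoc]

theorem diracG_of_fst_eq_zero {z s : ℂ} {ξ : Fin 2 × Fin n → ℂ} (h : ∀ k, ξ (0, k) = 0) (x : ℝ) :
    diracG y z s ξ 1 x = (-(1 / 2) + z) * ∑ k, schrKer s (x - y k) * ξ (1, k) ∧
    diracG y z s ξ 0 x = -Complex.I * ∑ k, schrKerDeriv s (x - y k) * ξ (1, k) := by
  simp [diracG, diracKer, h, Finset.mul_sum, mul_assoc, neg_div]

/-! #### The conditions `ξ ∈ ran Π` and `Π v = Θ ξ` in coordinates -/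

theorem coupleAlpha_proj_iff {ξ : Fin 2 × Fin n → ℂ} :
    (Couple.directSum fun k => coupleAlpha (γ k)).proj *ᵥ ξ = ξ ↔ ∀ k, ξ (1, k) = 0 := by
  simp [funext_iff, Prod.forall, Couple.directSum, blockDiagonal_mulVec_apply, coupleAlpha,
    Fin.forall_fin_two, eq_comm]

theorem coupleAlpha_theta_iff {ξ v : Fin 2 × Fin n → ℂ} :
    (Couple.directSum fun k => coupleAlpha (γ k)).proj *ᵥ v =
      (Couple.directSum fun k => coupleAlpha (γ k)).theta *ᵥ ξ ↔
        ∀ k, v (0, k) = (γ k : ℂ)⁻¹ * ξ (0, k) := by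
  simp [funext_iff, Prod.forall, Couple.directSum, blockDiagonal_mulVec_apply, coupleAlpha,
    Fin.forall_fin_two]

theorem coupleBeta_proj_iff {ξ : Fin 2 × Fin n → ℂ} :
    (Couple.directSum fun k => coupleBeta (γ k)).proj *ᵥ ξ = ξ ↔ ∀ k, ξ (0, k) = 0 := by
  simp [funext_iff, Prod.forall, Couple.directSum, blockDiagonal_mulVec_apply, coupleBeta,
    Fin.forall_fin_two, eq_comm]

theorem coupleBeta_theta_iff {ξ v : Fin 2 × Fin n → ℂ} :
    (Couple.directSum fun k => coupleBeta (γ k)).proj *ᵥ v =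
      (Couple.directSum fun k => coupleBeta (γ k)).theta *ᵥ ξ ↔
        ∀ k, v (1, k) = (γ k : ℂ)⁻¹ * ξ (1, k) := by
  simp [funext_iff, Prod.forall, Couple.directSum, blockDiagonal_mulVec_apply, coupleBeta,
    Fin.forall_fin_two]

theorem forall_fin_four {P : Fin 4 → Prop} : (∀ i, P i) ↔ P 0 ∧ P 1 ∧ P 2 ∧ P 3 := by
  simp [Fin.forall_fin_succ]

theorem coupleAlphaHat_proj_iff {ξ : Fin 4 × Fin n → ℂ} :
    (Couple.directSum fun k => coupleAlphaHat (γ k)).proj *ᵥ ξ = ξ ↔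
      ∀ k, ξ (1, k) = 0 ∧ ξ (2, k) = 0 := by
  simp only [funext_iff, Prod.forall, Couple.directSum, blockDiagonal_mulVec_apply, coupleAlphaHat,
    forall_fin_four, Fin.sum_univ_four]
  simp [forall_and, eq_comm]

theorem coupleAlphaHat_theta_iff {ξ v : Fin 4 × Fin n → ℂ} :
    (Couple.directSum fun k => coupleAlphaHat (γ k)).proj *ᵥ v =
      (Couple.directSum fun k => coupleAlphaHat (γ k)).theta *ᵥ ξ ↔
        ∀ k, v (0, k) = (γ k : ℂ)⁻¹ * (-Complex.I * ξ (3, k)) ∧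
          v (3, k) = (γ k : ℂ)⁻¹ * (Complex.I * ξ (0, k) - ξ (3, k)) := by
  simp only [funext_iff, Prod.forall, Couple.directSum, blockDiagonal_mulVec_apply, coupleAlphaHat,
    forall_fin_four, Fin.sum_univ_four]
  simp [forall_and, sub_eq_add_neg, mul_add, mul_assoc]

theorem coupleBetaHat_proj_iff {ξ : Fin 4 × Fin n → ℂ} :
    (Couple.directSum fun k => coupleBetaHat (γ k)).proj *ᵥ ξ = ξ ↔
      ∀ k, ξ (0, k) = 0 ∧ ξ (3, k) = 0 := by
  simp only [funext_iff, Prod.forall, Couple.directSum, blockDiagonal_mulVec_apply, coupleBetaHat,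
    forall_fin_four, Fin.sum_univ_four]
  simp [forall_and, eq_comm]

theorem coupleBetaHat_theta_iff {ξ v : Fin 4 × Fin n → ℂ} :
    (Couple.directSum fun k => coupleBetaHat (γ k)).proj *ᵥ v =
      (Couple.directSum fun k => coupleBetaHat (γ k)).theta *ᵥ ξ ↔
        ∀ k, v (1, k) = (γ k : ℂ)⁻¹ * (ξ (1, k) + Complex.I * ξ (2, k)) ∧
          v (2, k) = (γ k : ℂ)⁻¹ * (-Complex.I * ξ (1, k)) := by
  simp only [funext_iff, Prod.forall, Couple.directSum, blockDiagonal_mulVec_apply, coupleBetaHat,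
    forall_fin_four, Fin.sum_univ_four]
  simp [forall_and, mul_add, mul_assoc]

/-- The kernel `ĝ` is even; a charge in the first slot contributes `ĝ(· - yₖ)`. -/
theorem schrG_zero_right (s : ℂ) (X : Fin n → ℂ) (x : ℝ) :
    schrG y s X (fun _ => 0) x = ∑ k, schrKer s (x - y k) * X k := by
  refine Finset.sum_congr rfl fun k _ => ?_
  rw [← neg_sub, schrKer_neg, mul_zero, add_zero]

/-- The kernel `ĝ'` is odd, which turns `ĝ'(yₖ - ·)` into `-ĝ'(· - yₖ)`. -/
theorem schrG_zero_left (s : ℂ) (Z : Fin n → ℂ) (x : ℝ) :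
    schrG y s (fun _ => 0) Z x = (-1) * ∑ k, schrKerDeriv s (x - y k) * Z k := by
  rw [Finset.mul_sum]
  refine Finset.sum_congr rfl fun k _ => ?_
  rw [← neg_sub, schrKerDeriv_neg]; ring

/-- The equation `Π ⟨Ψ⟩ = Θ ξ` only sees the means of the continuous component; those of the other
component exist for every function in `H¹(ℝ \ Y)`. -/
theorem isDiracExtension_diracAlpha (hy : Function.Injective y) (hγ : ∀ k, γ k ≠ 0) :
    IsDiracExtension y (Couple.directSum fun k => coupleAlpha (γ k)) (diracAlpha y γ) := by
  intro z s hsz hs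
  have hm : (((1 / 2 : ℝ) : ℝ) : ℂ) = 1 / 2 := by push_cast; rfl
  have hsz' : s ^ 2 = z ^ 2 - (((1 / 2 : ℝ) : ℝ) : ℂ) ^ 2 := by rw [hsz, hm]; ring
  ext ⟨Ψ, Φ⟩
  rw [SetLike.mem_coe, mem_graph_diracAlpha]
  constructor
  · intro h
    obtain ⟨az, bz, X, h1, h2, h3, h4, h5, h6, h7⟩ := (diracRel_iff_exists hy hγ hsz' hs).mp h
    choose w hw using fun k => exists_hasMean h.snd_mem (y k)
    rw [hm] at h3 h6 h7
    refine ⟨WithLp.toLp 2 (az, bz), fun q => ![X q.2, 0] q.1,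
      fun q => ![(γ q.2 : ℂ)⁻¹ * X q.2, w q.2] q.1, h1, h2, coupleAlpha_proj_iff.mpr (by simp),
      ?_, ?_, fun k => ⟨h5 k, hw k⟩, coupleAlpha_theta_iff.mpr (by simp), spinor_ext h6 h7⟩
    · simp only [(diracG_of_snd_eq_zero (y := y) (z := z) (s := s)
        (ξ := fun q => ![X q.2, 0] q.1) (fun _ => rfl) _).1]
      exact (eq_add_iff_ae (coeFn_smul_kerSum hs _ X)).mp h3
    · simp only [(diracG_of_snd_eq_zero (y := y) (z := z) (s := s)
        (ξ := fun q => ![X q.2, 0] q.1) (fun _ => rfl) _).2]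
      exact (eq_add_iff_ae (coeFn_smul_kerDerivSum hs _ X)).mp h4
  · rintro ⟨Ψz, ξ, v, h1, h2, h3, h4, h5, h6, h7, h8⟩
    rw [coupleAlpha_proj_iff] at h3
    rw [coupleAlpha_theta_iff] at h7
    obtain ⟨h8, h9⟩ := spinor_ext_iff.mp h8
    simp only [(diracG_of_snd_eq_zero (y := y) (z := z) (s := s) h3 _).1] at h4
    simp only [(diracG_of_snd_eq_zero (y := y) (z := z) (s := s) h3 _).2] at h5
    rw [diracRel_iff_exists hy hγ hsz' hs, hm]
    exact ⟨Ψz.fst, Ψz.snd, fun k => ξ (0, k), h1, h2,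
      (eq_add_iff_ae (coeFn_smul_kerSum hs _ _)).mpr h4,
      (eq_add_iff_ae (coeFn_smul_kerDerivSum hs _ _)).mpr h5, fun k => h7 k ▸ (h6 k).1, h8, h9⟩

theorem isDiracExtension_diracBeta (hy : Function.Injective y) (hγ : ∀ k, γ k ≠ 0) :
    IsDiracExtension y (Couple.directSum fun k => coupleBeta (γ k)) (diracBeta y γ) := by
  intro z s hsz hs
  have hm : (((-(1 / 2) : ℝ) : ℝ) : ℂ) = -(1 / 2) := by push_cast; rfl
  have hsz' : s ^ 2 = z ^ 2 - (((-(1 / 2) : ℝ) : ℝ) : ℂ) ^ 2 := by rw [hsz, hm]; ring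
  ext ⟨Ψ, Φ⟩
  rw [SetLike.mem_coe, mem_graph_diracBeta]
  constructor
  · intro h
    obtain ⟨az, bz, X, h1, h2, h3, h4, h5, h6, h7⟩ := (diracRel_iff_exists hy hγ hsz' hs).mp h
    choose w hw using fun k => exists_hasMean h.snd_mem (y k)
    rw [hm] at h3 h6 h7
    rw [neg_smul _ az, ← sub_eq_add_neg] at h6
    rw [neg_smul _ bz, sub_neg_eq_add] at h7
    refine ⟨WithLp.toLp 2 (bz, az), fun q => ![0, X q.2] q.1,
      fun q => ![w q.2, (γ q.2 : ℂ)⁻¹ * X q.2] q.1, h2, h1, coupleBeta_proj_iff.mpr (by simp),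
      ?_, ?_, fun k => ⟨hw k, h5 k⟩, coupleBeta_theta_iff.mpr (by simp), spinor_ext h7 h6⟩
    · simp only [(diracG_of_fst_eq_zero (y := y) (z := z) (s := s)
        (ξ := fun q => ![0, X q.2] q.1) (fun _ => rfl) _).2]
      exact (eq_add_iff_ae (coeFn_smul_kerDerivSum hs _ X)).mp h4
    · simp only [(diracG_of_fst_eq_zero (y := y) (z := z) (s := s)
        (ξ := fun q => ![0, X q.2] q.1) (fun _ => rfl) _).1]
      exact (eq_add_iff_ae (coeFn_smul_kerSum hs _ X)).mp h3
  · rintro ⟨Ψz, ξ, v, h1, h2, h3, h4, h5, h6, h7, h8⟩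
    rw [coupleBeta_proj_iff] at h3
    rw [coupleBeta_theta_iff] at h7
    obtain ⟨h8, h9⟩ := spinor_ext_iff.mp h8
    simp only [(diracG_of_fst_eq_zero (y := y) (z := z) (s := s) h3 _).2] at h4
    simp only [(diracG_of_fst_eq_zero (y := y) (z := z) (s := s) h3 _).1] at h5
    rw [diracRel_iff_exists hy hγ hsz' hs, hm]
    refine ⟨Ψz.snd, Ψz.fst, fun k => ξ (1, k), h2, h1,
      (eq_add_iff_ae (coeFn_smul_kerSum hs _ _)).mpr h5,
      (eq_add_iff_ae (coeFn_smul_kerDerivSum hs _ _)).mpr h4, fun k => h7 k ▸ (h6 k).2, ?_, ?_⟩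
    · rw [neg_smul _ Ψz.snd, ← sub_eq_add_neg]; exact h9
    · rw [neg_smul _ Ψz.fst, sub_neg_eq_add]; exact h8

theorem isSchrExtension_squareSubQuarter_diracAlpha (hy : Function.Injective y)
    (hγ : ∀ k, γ k ≠ 0) :
    IsSchrExtension y (Couple.directSum fun k => coupleAlphaHat (γ k))
      (squareSubQuarter (diracAlpha y γ)) := by
  intro z s hsz hs
  have hm (c : ℂ) : (2 * ((1 / 2 : ℝ) : ℂ)) * c = c := by push_cast; ring
  ext ⟨Ψ, Φ⟩
  rw [SetLike.mem_coe, mem_graph_squareSubQuarter_diracAlpha]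
  constructor
  · intro h
    obtain ⟨az, bz, X, Z, h1, h2, h3, h4, h5, h6, h7, h8⟩ :=
      (schrDom_iff_exists hy hγ hsz hs).mp h
    choose w hw using fun k => exists_hasMean h.1.1.2 (y k)
    choose w' hw' using fun k => exists_hasMean h.1.2.1.1 (y k)
    simp only [hm] at h6
    refine ⟨WithLp.toLp 2 (az, bz), fun q => ![X q.2, 0, 0, Z q.2] q.1,
      fun q => ![(γ q.2 : ℂ)⁻¹ * (-Complex.I * Z q.2), w q.2, w' q.2,
        (γ q.2 : ℂ)⁻¹ * (Complex.I * X q.2 - Z q.2)] q.1, h1, h2,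
      coupleAlphaHat_proj_iff.mpr (by simp), ?_, ?_, fun k => ⟨h5 k, hw k, hw' k, h6 k⟩,
      coupleAlphaHat_theta_iff.mpr (by simp), spinor_ext h7 h8⟩
    · have := (eq_add_iff_ae (coeFn_kerSum hs y X)).mp h3
      simp only [← schrG_zero_right] at this
      exact this
    · rw [sub_eq_add_neg, ← neg_one_smul ℂ] at h4
      have := (eq_add_iff_ae (coeFn_smul_kerDerivSum hs _ Z)).mp h4
      simp only [← schrG_zero_left] at this
      exact this
  · rintro ⟨Ψz, ξ, v, h1, h2, h3, h4, h5, h6, h7, h8⟩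
    rw [coupleAlphaHat_proj_iff] at h3
    rw [coupleAlphaHat_theta_iff] at h7
    obtain ⟨h8, h9⟩ := spinor_ext_iff.mp h8
    simp only [(h3 _).1, schrG_zero_right] at h4
    simp only [(h3 _).2, schrG_zero_left] at h5
    rw [schrDom_iff_exists hy hγ hsz hs]
    refine ⟨Ψz.fst, Ψz.snd, fun k => ξ (0, k), fun k => ξ (3, k), h1, h2,
      (eq_add_iff_ae (coeFn_kerSum hs y _)).mpr h4, ?_, fun k => (h7 k).1 ▸ (h6 k).1,
      fun k => ?_, h8, h9⟩
    · rw [sub_eq_add_neg, ← neg_one_smul ℂ]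
      exact (eq_add_iff_ae (coeFn_smul_kerDerivSum hs _ _)).mpr h5
    · rw [hm, ← (h7 k).2]
      exact (h6 k).2.2.2

theorem isSchrExtension_squareSubQuarter_diracBeta (hy : Function.Injective y)
    (hγ : ∀ k, γ k ≠ 0) :
    IsSchrExtension y (Couple.directSum fun k => coupleBetaHat (γ k))
      (squareSubQuarter (diracBeta y γ)) := by
  intro z s hsz hs
  have hm (b c : ℂ) : b - (2 * ((-(1 / 2) : ℝ) : ℂ)) * c = c + b := by push_cast; ring
  ext ⟨Ψ, Φ⟩
  rw [SetLike.mem_coe, mem_graph_squareSubQuarter_diracBeta]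
  constructor
  · intro h
    obtain ⟨az, bz, X, Z, h1, h2, h3, h4, h5, h6, h7, h8⟩ :=
      (schrDom_iff_exists hy hγ hsz hs).mp h
    choose w hw using fun k => exists_hasMean h.1.1.2 (y k)
    choose w' hw' using fun k => exists_hasMean h.1.2.1.1 (y k)
    simp only [hm] at h6
    refine ⟨WithLp.toLp 2 (bz, az), fun q => ![0, Z q.2, X q.2, 0] q.1,
      fun q => ![w' q.2, (γ q.2 : ℂ)⁻¹ * (Z q.2 + Complex.I * X q.2),
        (γ q.2 : ℂ)⁻¹ * (-Complex.I * Z q.2), w q.2] q.1, h2, h1,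
      coupleBetaHat_proj_iff.mpr (by simp), ?_, ?_, fun k => ⟨hw' k, h6 k, h5 k, hw k⟩,
      coupleBetaHat_theta_iff.mpr (by simp), spinor_ext h8 h7⟩
    · rw [sub_eq_add_neg, ← neg_one_smul ℂ] at h4
      have := (eq_add_iff_ae (coeFn_smul_kerDerivSum hs _ Z)).mp h4
      simp only [← schrG_zero_left] at this
      exact this
    · have := (eq_add_iff_ae (coeFn_kerSum hs y X)).mp h3
      simp only [← schrG_zero_right] at this
      exact this
  · rintro ⟨Ψz, ξ, v, h1, h2, h3, h4, h5, h6, h7, h8⟩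
    rw [coupleBetaHat_proj_iff] at h3
    rw [coupleBetaHat_theta_iff] at h7
    obtain ⟨h8, h9⟩ := spinor_ext_iff.mp h8
    simp only [(h3 _).1, schrG_zero_left] at h4
    simp only [(h3 _).2, schrG_zero_right] at h5
    rw [schrDom_iff_exists hy hγ hsz hs]
    refine ⟨Ψz.snd, Ψz.fst, fun k => ξ (2, k), fun k => ξ (1, k), h2, h1,
      (eq_add_iff_ae (coeFn_kerSum hs y _)).mpr h5, ?_, fun k => (h7 k).2 ▸ (h6 k).2.2.1,
      fun k => ?_, h9, h8⟩
    · rw [sub_eq_add_neg, ← neg_one_smul ℂ]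
      exact (eq_add_iff_ae (coeFn_smul_kerDerivSum hs _ _)).mpr h4
    · rw [hm, ← (h7 k).1]
      exact (h6 k).2.1

end Extensions

/-! ### Domain and action of the Schrödinger operators -/

theorem mem_domain_squareSubQuarter_diracAlpha {n : ℕ} {y γ : Fin n → ℝ} (Ψ : Spinor) :
    Ψ ∈ (squareSubQuarter (diracAlpha y γ)).domain ↔ DomAlpha y γ Ψ := by
  rw [domAlpha_iff]
  constructor
  · exact fun h => (mem_graph_squareSubQuarter_diracAlpha.mp (LinearPMap.mem_graph _ ⟨Ψ, h⟩)).1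
  · exact fun h => (exists_map_of_mem_graph (mem_graph_squareSubQuarter_diracAlpha
      (Φ := schrAct (pts y) Ψ).mpr ⟨h, rfl, rfl⟩)).1

theorem mem_domain_squareSubQuarter_diracBeta {n : ℕ} {y γ : Fin n → ℝ} (Ψ : Spinor) :
    Ψ ∈ (squareSubQuarter (diracBeta y γ)).domain ↔ DomBeta y γ Ψ := by
  rw [domBeta_iff]
  constructor
  · exact fun h => (mem_graph_squareSubQuarter_diracBeta.mp (LinearPMap.mem_graph _ ⟨Ψ, h⟩)).1
  · exact fun h => (exists_map_of_mem_graph (mem_graph_squareSubQuarter_diracBeta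
      (Φ := schrAct (pts y) Ψ).mpr ⟨h, rfl, rfl⟩)).1

theorem squareSubQuarter_diracAlpha_apply {n : ℕ} {y γ : Fin n → ℝ}
    (Ψ : (squareSubQuarter (diracAlpha y γ)).domain) :
    squareSubQuarter (diracAlpha y γ) Ψ = schrAct (pts y) Ψ := by
  obtain ⟨-, h1, h2⟩ := mem_graph_squareSubQuarter_diracAlpha.mp (LinearPMap.mem_graph _ Ψ)
  exact spinor_ext h1 h2

theorem squareSubQuarter_diracBeta_apply {n : ℕ} {y γ : Fin n → ℝ}
    (Ψ : (squareSubQuarter (diracBeta y γ)).domain) :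
    squareSubQuarter (diracBeta y γ) Ψ = schrAct (pts y) Ψ := by
  obtain ⟨-, h1, h2⟩ := mem_graph_squareSubQuarter_diracBeta.mp (LinearPMap.mem_graph _ Ψ)
  exact spinor_ext h2 h1

end PointInt

end

theorem mainTheorem7 {n : ℕ} (y : Fin n → ℝ) (hy : StrictMono y) (α β : Fin n → ℝ) :
    (IsSelfAdjoint (PointInt.diracAlpha y α) ∧
      ∃ H : PointInt.Spinor →ₗ.[ℂ] PointInt.Spinor,
        IsSelfAdjoint H ∧
        PointInt.square (PointInt.diracAlpha y α) = PointInt.addQuarter H ∧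
        (∀ Ψ, Ψ ∈ H.domain ↔ PointInt.DomAlpha y α Ψ) ∧
        (∀ Ψ : H.domain, H Ψ = PointInt.schrAct (PointInt.pts y) Ψ) ∧
        ((∀ k, α k ≠ 0) →
          PointInt.IsDiracExtension y
            (PointInt.Couple.directSum fun k => PointInt.coupleAlpha (α k))
            (PointInt.diracAlpha y α) ∧
          PointInt.IsSchrExtension y
            (PointInt.Couple.directSum fun k => PointInt.coupleAlphaHat (α k)) H)) ∧
    (IsSelfAdjoint (PointInt.diracBeta y β) ∧
      ∃ H : PointInt.Spinor →ₗ.[ℂ] PointInt.Spinor,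
        IsSelfAdjoint H ∧
        PointInt.square (PointInt.diracBeta y β) = PointInt.addQuarter H ∧
        (∀ Ψ, Ψ ∈ H.domain ↔ PointInt.DomBeta y β Ψ) ∧
        (∀ Ψ : H.domain, H Ψ = PointInt.schrAct (PointInt.pts y) Ψ) ∧
        ((∀ k, β k ≠ 0) →
          PointInt.IsDiracExtension y
            (PointInt.Couple.directSum fun k => PointInt.coupleBeta (β k))
            (PointInt.diracBeta y β) ∧
          PointInt.IsSchrExtension y
            (PointInt.Couple.directSum fun k => PointInt.coupleBetaHat (β k)) H)) := by
  refine
    ⟨⟨PointInt.isSelfAdjoint_diracAlpha hy.injective,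
        PointInt.squareSubQuarter (PointInt.diracAlpha y α),
        PointInt.isSelfAdjoint_squareSubQuarter (PointInt.isSelfAdjoint_diracAlpha hy.injective),
        PointInt.addQuarter_squareSubQuarter _,
        PointInt.mem_domain_squareSubQuarter_diracAlpha,
        PointInt.squareSubQuarter_diracAlpha_apply, fun hα =>
          ⟨PointInt.isDiracExtension_diracAlpha hy.injective hα,
            PointInt.isSchrExtension_squareSubQuarter_diracAlpha hy.injective hα⟩⟩,
      ⟨PointInt.isSelfAdjoint_diracBeta hy.injective,
        PointInt.squareSubQuarter (PointInt.diracBeta y β),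
        PointInt.isSelfAdjoint_squareSubQuarter (PointInt.isSelfAdjoint_diracBeta hy.injective),
        PointInt.addQuarter_squareSubQuarter _,
        PointInt.mem_domain_squareSubQuarter_diracBeta,
        PointInt.squareSubQuarter_diracBeta_apply, fun hβ =>
          ⟨PointInt.isDiracExtension_diracBeta hy.injective hβ,
            PointInt.isSchrExtension_squareSubQuarter_diracBeta hy.injective hβ⟩⟩⟩
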